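/- Let $d\ge 1$ and let $\langle\cdot,\cdot\rangle$ be the inner product of $L^2(\mathbb R^d)$, antilinear in the second argument. For $z=(x,\omega)\in\mathbb R^{2d}$ let $\pi(z)\psi(t)=e^{2\pi i\omega\cdot t}\psi(t-x)$, let $V_\varphi\psi(z)=\langle\psi,\pi(z)\varphi\rangle$ and let $(\xi\otimes\eta)\zeta=\langle\zeta,\eta\rangle\xi$. For a measurable function $f$ on $\mathbb R^{2d}$, $\varphi_1,\varphi_2\in L^2(\mathbb R^d)$ and a bounded operator $S$ on $L^2(\mathbb R^d)$, define, as weak integrals (whenever these exist as bounded operators on $L^2(\mathbb R^d)$), $$\mathcal A_f^{\varphi_1,\varphi_2}\psi=\int_{\mathbb R^{2d}} f(z)\,V_{\varphi_1}\psi(z)\,\pi(z)\varphi_2\,dz,\qquad f\star S=\int_{\mathbb R^{2d}} f(z)\,\pi(z)S\pi(z)^*\,dz .$$ For $1\le p<\infty$ let $\mathcal T^p$ be the Schatten class of compact operators on $L^2(\mathbb R^d)$ whose singular values (counted with multiplicity) lie in $\ell^p$, with the $\ell^p$ norm of the singular values as norm, and let $\mathcal T^\infty=B(L^2(\mathbb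 R^d))$ with the operator norm. Let $1\le p<\infty$ and $1\le q,r\le\infty$ satisfy $\frac1p+\frac1q=1+\frac1r$. 1. Let $\{\varphi_{n,1}\}_{n\in\mathbb N}$ and $\{\varphi_{n,2}\}_{n\in\mathbb N}$ be orthonormal sequences in $L^2(\mathbb R^d)$ and let $\{\lambda_n\}_{n\in\mathbb N}\in\ell^p$ be a sequence of complex numbers. Then $S=\sum_{n=1}^\infty\lambda_n\,\varphi_{n,2}\otimes\varphi_{n,1}$ converges in the norm of $\mathcal T^p$. For every $f\in L^q(\mathbb R^{2d})$ the operators $\mathcal A_f^{\varphi_{n,1},\varphi_{n,2}}$ and $f\star S$ are well defined, the operators $\lambda_n\mathcal A_f^{\varphi_{n,1},\varphi_{n,2}}$ and $f\star S$ belong to $\mathcal T^r$, and $$\sum_{n=1}^{\infty}\lambda_n\mathcal A_f^{\varphi_{n,1},\varphi_{n,2}}=f\star\sum_{n=1}^\infty\lambda_n\,\varphi_{n,2}\otimes\varphi_{n,1},$$ where the series on the left converges in the norm of $\mathcal T^r$. 2. Conversely, let $S\in\mathcal T^p$. Then there are a sequence $\{\lambda_n\}_{n\in\mathbb N}\in\ell^p$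 of nonnegative numbers, all of them positive if $S$ has infinite rank, and orthonormal sequences $\{\varphi'_{n,1}\}_{n\in\mathbb N}$, $\{\varphi'_{n,2}\}_{n\in\mathbb N}$ in $L^2(\mathbb R^d)$ such that $S=\sum_{n=1}^\infty\lambda_n\,\varphi'_{n,2}\otimes\varphi'_{n,1}$ in the norm of $\mathcal T^p$ (a singular value decomposition of $S$) and such that, for every $f\in L^q(\mathbb R^{2d})$, the operators $\mathcal A_f^{\varphi'_{n,1},\varphi'_{n,2}}$ and $f\star S$ are well defined, the operators $\lambda_n\mathcal A_f^{\varphi'_{n,1},\varphi'_{n,2}}$ and $f\star S$ belong to $\mathcal T^r$, and $$f\star S=\sum_{n=1}^{\infty}\lambda_n\,\mathcal A_f^{\varphi'_{n,1},\varphi'_{n,2}}$$ with convergence in the norm of $\mathcal T^r$. -/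

import Mathlib

open MeasureTheory Filter Topology
open scoped ENNReal InnerProductSpace

noncomputable section

/-- The configuration space `ℝᵈ`, with its Euclidean structure. -/
abbrev Config (d : ℕ) : Type := EuclideanSpace ℝ (Fin d)

/-- The phase space `ℝ²ᵈ`, whose points are written `z = (x, ω)`; `volume` is Lebesgue measure. -/
abbrev Phase (d : ℕ) : Type := Config d × Config d

/-- The Hilbert space `L²(ℝᵈ)`. -/
abbrev L2 (d : ℕ) : Type := Lp ℂ 2 (volume : Measure (Config d))

/-! ### Time-frequency shifts, the STFT -/

/-- The function `t ↦ e^{2πi ω·t} g(t - x)`, where `z = (x, ω)`. -/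
def tfShiftFun {d : ℕ} (z : Phase d) (g : Config d → ℂ) (t : Config d) : ℂ :=
  Complex.exp (2 * Real.pi * Complex.I * ((inner ℝ z.2 t : ℝ) : ℂ)) * g (t - z.1)

theorem norm_tfShiftFun {d : ℕ} (z : Phase d) (g : Config d → ℂ) (t : Config d) :
    ‖tfShiftFun z g t‖ = ‖g (t - z.1)‖ := by
  have h : (2 * Real.pi * Complex.I * ((inner ℝ z.2 t : ℝ) : ℂ))
      = ((2 * Real.pi * (inner ℝ z.2 t : ℝ) : ℝ) : ℂ) * Complex.I := by
    push_cast; ring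
  rw [tfShiftFun, norm_mul, h, Complex.norm_exp_ofReal_mul_I, one_mul]

theorem tfShiftFun_congr {d : ℕ} (z : Phase d) {g h : Config d → ℂ}
    (e : g =ᵐ[volume] h) : tfShiftFun z g =ᵐ[volume] tfShiftFun z h := by
  have := (measurePreserving_sub_right (volume : Measure (Config d)) z.1).quasiMeasurePreserving.ae_eq
    e
  filter_upwards [this] with t ht
  simp only [Function.comp_apply] at ht
  simp only [tfShiftFun, ht]

theorem memLp_tfShiftFun {d : ℕ} (z : Phase d) {g : Config d → ℂ}
    (hg : MemLp g 2 (volume : Measure (Config d))) :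
    MemLp (tfShiftFun z g) 2 (volume : Measure (Config d)) := by
  have h1 : MemLp (fun t => g (t - z.1)) 2 (volume : Measure (Config d)) :=
    hg.comp_measurePreserving (measurePreserving_sub_right volume z.1)
  refine h1.of_le ?_ (Eventually.of_forall fun t => (norm_tfShiftFun z g t).le)
  refine AEStronglyMeasurable.mul ?_ h1.1
  exact Continuous.aestronglyMeasurable (by fun_prop)

/-- The time-frequency shift `π(z) = M_ω T_x`, `(π(z)ψ)(t) = e^{2πi ω·t} ψ(t - x)`, as an isometry of
`L²(ℝᵈ)`. -/
def tfShiftIsometry {d : ℕ} (z : Phase d) : L2 d →ₗᵢ[ℂ] L2 d where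
  toFun ψ := (memLp_tfShiftFun z (Lp.memLp ψ)).toLp (tfShiftFun z ψ)
  map_add' ψ η := by
    rw [← MemLp.toLp_add, MemLp.toLp_eq_toLp_iff]
    refine (tfShiftFun_congr z (Lp.coeFn_add ψ η)).trans (Eventually.of_forall fun t => ?_)
    simp only [tfShiftFun, Pi.add_apply]; ring
  map_smul' c ψ := by
    rw [RingHom.id_apply, ← MemLp.toLp_const_smul, MemLp.toLp_eq_toLp_iff]
    refine (tfShiftFun_congr z (Lp.coeFn_smul c ψ)).trans (Eventually.of_forall fun t => ?_)
    simp only [tfShiftFun, Pi.smul_apply, smul_eq_mul]; ring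
  norm_map' ψ := by
    simp only [LinearMap.coe_mk, AddHom.coe_mk]
    rw [Lp.norm_toLp, Lp.norm_def, eLpNorm_congr_norm_ae (Eventually.of_forall (norm_tfShiftFun z ψ))]
    congr 1
    exact eLpNorm_comp_measurePreserving (Lp.aestronglyMeasurable ψ)
      (measurePreserving_sub_right volume z.1)

/-- The time-frequency shift `π(z)` as a bounded operator on `L²(ℝᵈ)`. -/
def tfShift {d : ℕ} (z : Phase d) : L2 d →L[ℂ] L2 d := (tfShiftIsometry z).toContinuousLinearMap

/-- The short-time Fourier transform `V_φ ψ(z) = ⟨ψ, π(z)φ⟩` with window `φ`.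
Mathlib's inner product is antilinear in its first argument, the one of the formula in its second. -/
def stft {d : ℕ} (φ ψ : L2 d) (z : Phase d) : ℂ := ⟪tfShift z φ, ψ⟫_ℂ

/-! ### Weak operator-valued integrals -/

/-- `T` is the weak and pointwise integral over phase space of the operators `ψ ↦ G z ψ`:
`⟨Tψ, η⟩ = ∫ ⟨G z ψ, η⟩ dz` for all `ψ, η`, all these integrals being absolutely convergent. -/
def IsWeakIntegral {d : ℕ} (G : Phase d → L2 d → L2 d) (T : L2 d →L[ℂ] L2 d) : Prop :=
  ∀ ψ η : L2 d, Integrable (fun z => ⟪η, G z ψ⟫_ℂ) volume ∧ ⟪η, T ψ⟫_ℂ = ∫ z, ⟪η, G z ψ⟫_ℂ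

/-- The weak integral of `G` exists as a bounded operator on `L²(ℝᵈ)`. -/
def WeaklyIntegrable {d : ℕ} (G : Phase d → L2 d → L2 d) : Prop :=
  ∃ T : L2 d →L[ℂ] L2 d, IsWeakIntegral G T

theorem IsWeakIntegral.unique {d : ℕ} {G : Phase d → L2 d → L2 d} {T T' : L2 d →L[ℂ] L2 d}
    (h : IsWeakIntegral G T) (h' : IsWeakIntegral G T') : T = T' := by
  ext1 ψ
  exact ext_inner_left ℂ fun η => (h ψ η).2.trans (h' ψ η).2.symm

open Classical in
/-- The weak integral of `G` (the zero operator if it does not exist). -/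
def weakIntegral {d : ℕ} (G : Phase d → L2 d → L2 d) : L2 d →L[ℂ] L2 d :=
  if h : WeaklyIntegrable G then h.choose else 0

theorem IsWeakIntegral.weakIntegral_eq {d : ℕ} {G : Phase d → L2 d → L2 d} {T : L2 d →L[ℂ] L2 d}
    (h : IsWeakIntegral G T) : weakIntegral G = T := by
  have h' : WeaklyIntegrable G := ⟨T, h⟩
  rw [weakIntegral, dif_pos h']
  exact h'.choose_spec.unique h

/-! ### Localization operators and convolutions of functions with operators -/

/-- The integrand `f(z) V_{φ₁}ψ(z) π(z)φ₂` of the localization operator. -/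
def locIntegrand {d : ℕ} (f : Phase d → ℂ) (φ₁ φ₂ : L2 d) (z : Phase d) (ψ : L2 d) : L2 d :=
  (f z * stft φ₁ ψ z) • tfShift z φ₂

/-- The localization operator (STFT-filter) with mask `f` and windows `φ₁`, `φ₂`,
`A_f^{φ₁,φ₂} ψ = ∫ f(z) V_{φ₁}ψ(z) π(z)φ₂ dz`. -/
def locOp {d : ℕ} (f : Phase d → ℂ) (φ₁ φ₂ : L2 d) : L2 d →L[ℂ] L2 d :=
  weakIntegral (locIntegrand f φ₁ φ₂)

/-- The shift `α_z(S) = π(z) S π(z)*` of an operator. -/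
def opShift {d : ℕ} (z : Phase d) (S : L2 d →L[ℂ] L2 d) : L2 d →L[ℂ] L2 d :=
  tfShift z ∘L S ∘L ContinuousLinearMap.adjoint (tfShift z)

/-- The integrand `f(z) α_z(S)` of the convolution. -/
def convIntegrand {d : ℕ} (f : Phase d → ℂ) (S : L2 d →L[ℂ] L2 d) (z : Phase d) (ψ : L2 d) : L2 d :=
  f z • opShift z S ψ

/-- The convolution `f ⋆ S = ∫ f(z) α_z(S) dz` of a function and an operator. -/
def opConv {d : ℕ} (f : Phase d → ℂ) (S : L2 d →L[ℂ] L2 d) : L2 d →L[ℂ] L2 d :=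
  weakIntegral (convIntegrand f S)

/-- The rank-one operator `ξ ⊗ η`, `(ξ ⊗ η) ζ = ⟨ζ, η⟩ ξ`. -/
def rankOneOp {d : ℕ} (ξ η : L2 d) : L2 d →L[ℂ] L2 d := InnerProductSpace.rankOne ℂ ξ η

/-! ### Schatten classes -/

/-- The multiplicity of `s > 0` as a singular value of the compact operator `S`: the dimension of
the eigenspace of `|S|` for `s`, which is the eigenspace of `S*S` for `s²`. -/
def singularMult {d : ℕ} (S : L2 d →L[ℂ] L2 d) (s : ℝ) : ℕ :=
  Module.finrank ℂ
    (Module.End.eigenspace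
      ((ContinuousLinearMap.adjoint S ∘L S : L2 d →L[ℂ] L2 d) : L2 d →ₗ[ℂ] L2 d) ((s ^ 2 : ℝ) : ℂ))

open Classical in
/-- The Schatten norm, with values in `[0, ∞]`: the `ℓᵖ` norm of the singular values, counted with
multiplicity, if `p < ∞` and `S` is compact; `∞` if `p < ∞` and `S` is not compact; the operator norm
if `p = ∞`. -/
def schattenNorm {d : ℕ} (p : ℝ≥0∞) (S : L2 d →L[ℂ] L2 d) : ℝ≥0∞ :=
  if p = ∞ then ‖S‖ₑ
  else if IsCompactOperator S then
    (∑' s : {s : ℝ // 0 < s}, (singularMult S s : ℝ≥0∞) * ENNReal.ofReal s ^ p.toReal)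
      ^ (1 / p.toReal)
  else ∞

/-- Membership in the Schatten class `𝒯ᵖ`; `𝒯^∞` consists of all bounded operators. -/
def MemSchatten {d : ℕ} (p : ℝ≥0∞) (S : L2 d →L[ℂ] L2 d) : Prop := schattenNorm p S < ∞

/-- The series `∑ₙ Aₙ` of elements of `𝒯ᵖ` converges to the element `T` of `𝒯ᵖ`, in the norm
of `𝒯ᵖ`. -/
def HasSchattenSum {d : ℕ} (p : ℝ≥0∞) (A : ℕ → L2 d →L[ℂ] L2 d) (T : L2 d →L[ℂ] L2 d) : Prop :=
  (∀ n, MemSchatten p (A n)) ∧ MemSchatten p T ∧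
    Tendsto (fun N : ℕ => schattenNorm p (∑ n ∈ Finset.range N, A n - T)) atTop (𝓝 0)

end

/-!
The convolution `f ⋆ S` is linear in `S`, and `𝒜_f^{φ₁,φ₂} = f ⋆ (φ₂ ⊗ φ₁)`, since the two integrands
coincide (`locIntegrand_eq_convIntegrand`). Hence the error after `N` terms of the series is
`f ⋆ R_N`, where `R_N` is (up to sign) the remainder of the singular series of `S`, and everything
follows from the Werner-Young inequality `‖f ⋆ S‖_{𝒯ʳ} ≤ ‖f‖_q ‖c‖_p` for operators
`S = ∑ cₙ φ₂ₙ ⊗ φ₁ₙ` with orthonormal `φ₁`, `φ₂` (`IsSingularSeries.exists_conv`), because the `ℓᵖ`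
norms of the remainders of a sequence in `ℓᵖ`, `p < ∞`, tend to zero.

The Werner-Young inequality is proved without interpolation and without duality of Schatten classes.
An operator `T` has `‖T‖_{𝒯ʳ} ≤ C` as soon as `∑ |⟨T eᵢ, gᵢ⟩|^r ≤ C^r` for all finite orthonormal
families `e`, `g` (`schattenNorm_le_of_sum_inner_le`). For `T = f ⋆ S` these numbers are at most
`∫ |f(z)| ∑ₙ |cₙ| k(i, z, n) dz` with the kernel `k(i, z, n) = |V_{φ₁ₙ}eᵢ(z)| |V_{φ₂ₙ}gᵢ(z)|`. By the
Cauchy-Schwarz inequality and Bessel's inequality the sums of `k` over `n` and over `i` are at most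
`1`, and by Moyal's identity (`lintegral_enorm_stft_sq_le`, a consequence of Plancherel's theorem) so
are its integrals over `z`. For such kernels the classical proof of Young's inequality, Hölder's
inequality with three factors, applies (`sum_lintegral_kernel_rpow_le`). On a one-point space instead
of phase space the same inequality bounds the `𝒯ᵖ` norm of a singular series.

For the converse, the spectral theorem for the compact operator `S*S` gives the singular value
decomposition of `S` (`exists_singularValueDecomposition`). If `S` has finite rank, the orthonormal
families of singular vectors are extended to sequences, which is possible because `L²(ℝᵈ)` is
infinite-dimensional for `d ≥ 1` (`not_finiteDimensional_L2`).
-/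

/-! ### Plancherel's inequality and the orthogonality relation of the short-time Fourier transform -/

section Plancherel

open FourierTransform SchwartzMap
open scoped ContDiff

variable {V : Type*} [NormedAddCommGroup V] [InnerProductSpace ℝ V] [FiniteDimensional ℝ V]
  [MeasurableSpace V] [BorelSpace V]

/-- On `L¹ ∩ L²` the Fourier integral agrees with the unitary Fourier transform of `L²`: both
represent the same tempered distribution. -/
theorem coeFn_fourier_toLp_ae_eq {h : V → ℂ} (h1 : Integrable h) (h2 : MemLp h 2 volume) :
    ((𝓕 (h2.toLp h) : Lp ℂ 2 (volume : Measure V)) : V → ℂ) =ᵐ[volume] 𝓕 h := by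
  have hcont : Continuous (𝓕 h) :=
    VectorFourier.fourierIntegral_continuous Real.continuous_fourierChar
      (by exact continuous_inner) h1
  refine ae_eq_of_integral_contDiff_smul_eq
    ((Lp.memLp _).locallyIntegrable one_le_two) hcont.locallyIntegrable fun g hg hgc => ?_
  have hg₁ : HasCompactSupport (Complex.ofRealCLM ∘ g) := hgc.comp_left rfl
  have hg₂ : ContDiff ℝ ∞ (Complex.ofRealCLM ∘ g) := by fun_prop
  let G : 𝓢(V, ℂ) := hg₁.toSchwartzMap hg₂
  have key := congrArg (fun T => T G) (Lp.fourier_toTemperedDistribution_eq (h2.toLp h))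
  simp only [TemperedDistribution.fourier_apply, Lp.toTemperedDistribution_apply] at key
  have e1 : ∫ x, (𝓕 G : 𝓢(V, ℂ)) x • (h2.toLp h : V → ℂ) x = ∫ x, 𝓕 (G : V → ℂ) x • h x := by
    refine integral_congr_ae ?_
    filter_upwards [h2.coeFn_toLp] with x hx
    rw [hx, SchwartzMap.fourier_coe]
  have e2 : ∫ x, 𝓕 (G : V → ℂ) x • h x = ∫ x, G x • 𝓕 h x := by
    have := VectorFourier.integral_fourierIntegral_smul_eq_flip (L := innerₗ V)
      (μ := volume) (ν := volume) (f := (G : V → ℂ)) (g := h)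
      Real.continuous_fourierChar (by exact continuous_inner) G.integrable h1
    rw [flip_innerₗ] at this
    exact this
  have e3 : ∀ F : V → ℂ, ∫ x, g x • F x = ∫ x, G x • F x := fun F => by
    refine integral_congr_ae (Eventually.of_forall fun x => ?_)
    simp [G]
  rw [e3, e3, ← e2, ← e1, key]

/-- Half of Plancherel's theorem for integrable functions; the right-hand side may be infinite. -/
theorem lintegral_enorm_fourier_sq_le {h : V → ℂ} (h1 : Integrable h) :
    ∫⁻ ξ, ‖𝓕 h ξ‖ₑ ^ (2 : ℝ) ≤ ∫⁻ t, ‖h t‖ₑ ^ (2 : ℝ) := by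
  by_cases h2 : MemLp h 2 volume
  · have e : ∀ F : V → ℂ, ∫⁻ t, ‖F t‖ₑ ^ (2 : ℝ) = eLpNorm F 2 volume ^ (2 : ℝ) := fun F => by
      rw [eLpNorm_eq_lintegral_rpow_enorm_toReal two_ne_zero ENNReal.ofNat_ne_top,
        ENNReal.toReal_ofNat, ← ENNReal.rpow_mul]
      norm_num
    rw [e, e, ← eLpNorm_congr_ae (coeFn_fourier_toLp_ae_eq h1 h2), ← Lp.enorm_def,
      ← eLpNorm_congr_ae h2.coeFn_toLp, ← Lp.enorm_def, ← ofReal_norm, ← ofReal_norm,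
      Lp.norm_fourier_eq]
  · have : ∫⁻ t, ‖h t‖ₑ ^ (2 : ℝ) = ⊤ := by
      by_contra hne
      refine h2 ⟨h1.1, ?_⟩
      rw [eLpNorm_lt_top_iff_lintegral_rpow_enorm_lt_top two_ne_zero ENNReal.ofNat_ne_top]
      simpa using lt_top_iff_ne_top.2 hne
    rw [this]; exact le_top

end Plancherel

section STFT

open FourierTransform

variable {d : ℕ}

theorem norm_tfShift (z : Phase d) (φ : L2 d) : ‖tfShift z φ‖ = ‖φ‖ :=
  (tfShiftIsometry z).norm_map φ

theorem coeFn_tfShift (z : Phase d) (φ : L2 d) : tfShift z φ =ᵐ[volume] tfShiftFun z φ :=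
  (memLp_tfShiftFun z (Lp.memLp φ)).coeFn_toLp

theorem orthonormal_tfShift (z : Phase d) {ι : Type*} {φ : ι → L2 d} (hφ : Orthonormal ℂ φ) :
    Orthonormal ℂ fun n => tfShift z (φ n) :=
  hφ.comp_linearIsometry (tfShiftIsometry z)

theorem stft_eq_integral (φ ψ : L2 d) (z : Phase d) :
    stft φ ψ z = ∫ t, ψ t * (starRingEnd ℂ) (tfShiftFun z φ t) := by
  rw [stft, L2.inner_def]
  refine integral_congr_ae ?_
  filter_upwards [coeFn_tfShift z φ] with t ht
  rw [ht]; rfl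

/-- For fixed `x`, `V_φ ψ(x, ·)` is the Fourier transform of the product of `ψ` with the complex
conjugate of `φ(· - x)`. -/
theorem stft_eq_fourier (φ ψ : L2 d) (x ω : Config d) :
    stft φ ψ (x, ω) = 𝓕 (fun t => ψ t * (starRingEnd ℂ) (φ (t - x))) ω := by
  rw [stft_eq_integral, Real.fourier_eq']
  refine integral_congr_ae (Eventually.of_forall fun t => ?_)
  simp only [tfShiftFun, map_mul, smul_eq_mul, ← Complex.exp_conj, Complex.conj_I,
    Complex.conj_ofReal, map_ofNat, real_inner_comm t ω]
  push_cast
  ring_nf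

theorem measurable_stft (φ ψ : L2 d) : Measurable (stft φ ψ) := by
  have hφ := (Lp.stronglyMeasurable φ).measurable
  have hψ := (Lp.stronglyMeasurable ψ).measurable
  have : stft φ ψ = fun z => ∫ t, ψ t * (starRingEnd ℂ) (tfShiftFun z φ t) :=
    funext (stft_eq_integral φ ψ)
  rw [this]
  refine (StronglyMeasurable.integral_prod_right
    (f := fun z t => ψ t * (starRingEnd ℂ) (tfShiftFun z φ t)) ?_).measurable
  refine Measurable.stronglyMeasurable ?_
  have hexp : Measurable fun p : Phase d × Config d =>
      Complex.exp (2 * Real.pi * Complex.I * ((inner ℝ p.1.2 p.2 : ℝ) : ℂ)) :=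
    Continuous.measurable (by fun_prop)
  have hsub : Measurable fun p : Phase d × Config d => p.2 - p.1.1 :=
    Continuous.measurable (by fun_prop)
  exact (hψ.comp measurable_snd).mul
    (Complex.continuous_conj.measurable.comp (hexp.mul (hφ.comp hsub)))

/-- Half of the orthogonality relation (Moyal's identity) of the short-time Fourier transform. -/
theorem lintegral_enorm_stft_sq_le (φ ψ : L2 d) :
    ∫⁻ z, ‖stft φ ψ z‖ₑ ^ (2 : ℝ) ≤ ‖φ‖ₑ ^ (2 : ℝ) * ‖ψ‖ₑ ^ (2 : ℝ) := by
  have hφ := (Lp.stronglyMeasurable φ).measurable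
  have hψ := (Lp.stronglyMeasurable ψ).measurable
  have hnorm : ∀ F : L2 d, ∫⁻ t, ‖F t‖ₑ ^ (2 : ℝ) = ‖F‖ₑ ^ (2 : ℝ) := fun F => by
    rw [Lp.enorm_def,
      eLpNorm_eq_lintegral_rpow_enorm_toReal two_ne_zero ENNReal.ofNat_ne_top,
      ENNReal.toReal_ofNat, ← ENNReal.rpow_mul]
    norm_num
  have hint : ∀ x : Config d, Integrable fun t => ψ t * (starRingEnd ℂ) (φ (t - x)) := fun x => by
    have h1 : MemLp (fun t => φ (t - x)) 2 (volume : Measure (Config d)) :=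
      (Lp.memLp φ).comp_measurePreserving (measurePreserving_sub_right volume x)
    exact (Lp.memLp ψ).integrable_mul h1.star
  calc ∫⁻ z, ‖stft φ ψ z‖ₑ ^ (2 : ℝ)
      = ∫⁻ x, ∫⁻ ω, ‖stft φ ψ (x, ω)‖ₑ ^ (2 : ℝ) := by
        rw [Measure.volume_eq_prod, lintegral_prod]
        exact ((measurable_stft φ ψ).enorm.pow_const _).aemeasurable
    _ ≤ ∫⁻ x, ∫⁻ t, ‖ψ t * (starRingEnd ℂ) (φ (t - x))‖ₑ ^ (2 : ℝ) := by
        refine lintegral_mono fun x => ?_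
        simp only [stft_eq_fourier]
        exact lintegral_enorm_fourier_sq_le (hint x)
    _ = ∫⁻ t, ∫⁻ x, ‖ψ t‖ₑ ^ (2 : ℝ) * ‖φ (t - x)‖ₑ ^ (2 : ℝ) := by
        rw [lintegral_lintegral_swap]
        · refine lintegral_congr fun t => lintegral_congr fun x => ?_
          rw [enorm_mul, ENNReal.mul_rpow_of_nonneg _ _ zero_le_two, RCLike.enorm_conj]
        · have hsub : Measurable fun p : Config d × Config d => p.2 - p.1 :=
            Continuous.measurable (by fun_prop)
          exact (((hψ.comp measurable_snd).mul (Complex.continuous_conj.measurable.comp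
            (hφ.comp hsub))).enorm.pow_const _).aemeasurable
    _ = ∫⁻ t, ‖ψ t‖ₑ ^ (2 : ℝ) * ‖φ‖ₑ ^ (2 : ℝ) := by
        refine lintegral_congr fun t => ?_
        rw [lintegral_const_mul', lintegral_sub_left_eq_self (fun y => ‖φ y‖ₑ ^ (2 : ℝ)), hnorm]
        exact ENNReal.rpow_ne_top_of_nonneg zero_le_two enorm_ne_top
    _ = ‖φ‖ₑ ^ (2 : ℝ) * ‖ψ‖ₑ ^ (2 : ℝ) := by
        rw [lintegral_mul_const _ (hψ.enorm.pow_const _), hnorm, mul_comm]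

end STFT

/-! ### Young's inequality for kernels with bounded marginals -/

section Kernel

/-- The Cauchy-Schwarz inequality, for given bounds `A` and `B` of the `L²` norms. -/
theorem lintegral_mul_le_of_lintegral_sq_le {X : Type*} [MeasurableSpace X] {μ : Measure X}
    {a b : X → ℝ≥0∞} (ha : AEMeasurable a μ) (hb : AEMeasurable b μ) {A B : ℝ≥0∞}
    (hA : ∫⁻ x, a x ^ (2 : ℝ) ∂μ ≤ A ^ (2 : ℝ)) (hB : ∫⁻ x, b x ^ (2 : ℝ) ∂μ ≤ B ^ (2 : ℝ)) :
    ∫⁻ x, a x * b x ∂μ ≤ A * B := by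
  have hroot : ∀ {I C : ℝ≥0∞}, I ≤ C ^ (2 : ℝ) → I ^ (1 / (2 : ℝ)) ≤ C := fun {I C} h => by
    rw [one_div, ENNReal.rpow_inv_le_iff two_pos]; exact h
  exact (ENNReal.lintegral_mul_le_Lp_mul_Lq μ Real.HolderConjugate.two_two ha hb).trans
    (mul_le_mul' (hroot hA) (hroot hB))

theorem tsum_mul_le_of_tsum_sq_le {ι : Type*} {a b : ι → ℝ≥0∞} {A B : ℝ≥0∞}
    (hA : ∑' i, a i ^ (2 : ℝ) ≤ A ^ (2 : ℝ)) (hB : ∑' i, b i ^ (2 : ℝ) ≤ B ^ (2 : ℝ)) :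
    ∑' i, a i * b i ≤ A * B := by
  let _ : MeasurableSpace ι := ⊤
  simp only [← lintegral_count] at hA hB ⊢
  exact lintegral_mul_le_of_lintegral_sq_le (measurable_from_top).aemeasurable
    (measurable_from_top).aemeasurable hA hB

variable {X : Type*} [MeasurableSpace X] {μ : Measure X}

theorem lintegral_prod_count {G : X × ℕ → ℝ≥0∞} (hG : AEMeasurable G (μ.prod Measure.count)) :
    ∫⁻ z, G z ∂(μ.prod Measure.count) = ∫⁻ x, ∑' n, G (x, n) ∂μ := by
  rw [lintegral_prod _ hG]
  simp only [lintegral_count]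

variable {f : X → ℝ≥0∞} {c : ℕ → ℝ≥0∞} {k : X → ℕ → ℝ≥0∞} {A : ℝ≥0∞}

/-- Hölder's inequality for three factors, with exponents `1/α`, `1/β`, `1/γ`, applied to the
splitting `f c k = (f^q c^p k)^α (f^q k)^β (c^p k)^γ`. -/
theorem lintegral_kernel_le_holder (hf : AEMeasurable f μ)
    (hk : ∀ n, Measurable fun x => k x n) (hsum : ∀ x, ∑' n, k x n ≤ A)
    (hint : ∀ n, ∫⁻ x, k x n ∂μ ≤ A) {p q α β γ : ℝ} (hα : 0 ≤ α) (hβ : 0 ≤ β) (hγ : 0 ≤ γ)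
    (hone : α + β + γ = 1) (hq : q * (α + β) = 1)
    (hp : p * (α + γ) = 1) :
    ∫⁻ x, f x * ∑' n, c n * k x n ∂μ ≤ (∫⁻ x, f x ^ q * ∑' n, c n ^ p * k x n ∂μ) ^ α *
      ((A * ∫⁻ x, f x ^ q ∂μ) ^ β * (A * ∑' n, c n ^ p) ^ γ) := by
  have hK : Measurable fun z : X × ℕ => k z.1 z.2 := measurable_from_prod_countable_left hk
  have hfst : AEMeasurable (fun z : X × ℕ => f z.1) (μ.prod Measure.count) := hf.comp_fst
  have hcn : ∀ h : ℕ → ℝ≥0∞, Measurable fun z : X × ℕ => h z.2 := fun h =>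
    (measurable_from_top (f := h)).comp measurable_snd
  let F : Fin 3 → X × ℕ → ℝ≥0∞ :=
    ![fun z => f z.1 ^ q * (c z.2 ^ p * k z.1 z.2), fun z => f z.1 ^ q * k z.1 z.2,
      fun z => c z.2 ^ p * k z.1 z.2]
  have hF0 : AEMeasurable (F 0) (μ.prod Measure.count) :=
    (hfst.pow_const q).mul ((hcn fun n => c n ^ p).mul hK).aemeasurable
  have hF1 : AEMeasurable (F 1) (μ.prod Measure.count) := (hfst.pow_const q).mul hK.aemeasurable
  have hF2 : AEMeasurable (F 2) (μ.prod Measure.count) :=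
    ((hcn fun n => c n ^ p).mul hK).aemeasurable
  have hsplit : ∀ z : X × ℕ, f z.1 * (c z.2 * k z.1 z.2)
      = ∏ i, F i z ^ (![α, β, γ] : Fin 3 → ℝ) i := fun z => by
    simp only [Fin.prod_univ_three, F, Matrix.cons_val_zero, Matrix.cons_val_one,
      Matrix.cons_val_two, Matrix.head_cons, Matrix.tail_cons]
    have e1 : f z.1 = (f z.1 ^ q) ^ α * (f z.1 ^ q) ^ β := by
      rw [← ENNReal.rpow_add_of_nonneg _ _ hα hβ, ← ENNReal.rpow_mul, hq, ENNReal.rpow_one]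
    have e2 : c z.2 = (c z.2 ^ p) ^ α * (c z.2 ^ p) ^ γ := by
      rw [← ENNReal.rpow_add_of_nonneg _ _ hα hγ, ← ENNReal.rpow_mul, hp, ENNReal.rpow_one]
    have e3 : k z.1 z.2 = k z.1 z.2 ^ α * k z.1 z.2 ^ β * k z.1 z.2 ^ γ := by
      rw [← ENNReal.rpow_add_of_nonneg _ _ hα hβ,
        ← ENNReal.rpow_add_of_nonneg _ _ (add_nonneg hα hβ) hγ, hone, ENNReal.rpow_one]
    simp only [ENNReal.mul_rpow_of_nonneg _ _ hα, ENNReal.mul_rpow_of_nonneg _ _ hβ,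
      ENNReal.mul_rpow_of_nonneg _ _ hγ]
    calc f z.1 * (c z.2 * k z.1 z.2)
        = ((f z.1 ^ q) ^ α * (f z.1 ^ q) ^ β) * (((c z.2 ^ p) ^ α * (c z.2 ^ p) ^ γ) *
          (k z.1 z.2 ^ α * k z.1 z.2 ^ β * k z.1 z.2 ^ γ)) := by rw [← e1, ← e2, ← e3]
      _ = _ := by ring
  have hH := ENNReal.lintegral_prod_norm_pow_le (μ := μ.prod Measure.count) Finset.univ (f := F)
    (p := ![α, β, γ]) (by intro i _; fin_cases i; exacts [hF0, hF1, hF2])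
    (by simpa [Fin.sum_univ_three] using hone)
    (by intro i _; fin_cases i; exacts [hα, hβ, hγ])
  simp only [← hsplit] at hH
  have hG : AEMeasurable (fun z : X × ℕ => f z.1 * (c z.2 * k z.1 z.2)) (μ.prod Measure.count) :=
    hfst.mul ((hcn c).mul hK).aemeasurable
  rw [lintegral_prod_count hG, Fin.prod_univ_three,
    lintegral_prod_count hF0, lintegral_prod_count hF1, lintegral_prod_count hF2] at hH
  simp only [F, Matrix.cons_val_zero, Matrix.cons_val_one, Matrix.cons_val, ENNReal.tsum_mul_left]
    at hH
  refine hH.trans ?_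
  rw [mul_assoc]
  gcongr
  · rw [mul_comm A, ← lintegral_mul_const'' _ (hf.pow_const q)]
    gcongr with x
    exact hsum x
  · rw [lintegral_tsum fun n => ((hk n).const_mul _).aemeasurable, mul_comm A,
      ← ENNReal.tsum_mul_right]
    refine ENNReal.tsum_le_tsum fun n => ?_
    rw [lintegral_const_mul _ (hk n)]
    gcongr
    exact hint n

/-- The bound of a single entry in Young's inequality. It covers the target space `ℓ^∞`, for which
`α = 0`. -/
theorem lintegral_kernel_le (hf : AEMeasurable f μ)
    (hk : ∀ n, Measurable fun x => k x n) (hsum : ∀ x, ∑' n, k x n ≤ A)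
    (hint : ∀ n, ∫⁻ x, k x n ∂μ ≤ A) {p q α β γ : ℝ} (hα : 0 ≤ α) (hβ : 0 ≤ β) (hγ : 0 ≤ γ)
    (hone : α + β + γ = 1) (hq : q * (α + β) = 1)
    (hp : p * (α + γ) = 1) :
    ∫⁻ x, f x * ∑' n, c n * k x n ∂μ ≤
      A * ((∫⁻ x, f x ^ q ∂μ) ^ (α + β) * (∑' n, c n ^ p) ^ (α + γ)) := by
  refine (lintegral_kernel_le_holder hf hk hsum hint hα hβ hγ hone hq hp).trans ?_
  have h0 : ∫⁻ x, f x ^ q * ∑' n, c n ^ p * k x n ∂μ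
      ≤ A * ((∫⁻ x, f x ^ q ∂μ) * ∑' n, c n ^ p) := by
    rw [mul_left_comm, ← lintegral_mul_const'' _ (hf.pow_const q)]
    gcongr with x
    rw [mul_comm, ← ENNReal.tsum_mul_right]
    gcongr with n
    exact (ENNReal.le_tsum n).trans (hsum x)
  calc _ ≤ (A * ((∫⁻ x, f x ^ q ∂μ) * ∑' n, c n ^ p)) ^ α *
      ((A * ∫⁻ x, f x ^ q ∂μ) ^ β * (A * ∑' n, c n ^ p) ^ γ) := by gcongr
    _ = (A ^ α * A ^ β * A ^ γ) * (((∫⁻ x, f x ^ q ∂μ) ^ α * (∫⁻ x, f x ^ q ∂μ) ^ β) *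
        ((∑' n, c n ^ p) ^ α * (∑' n, c n ^ p) ^ γ)) := by
      simp only [ENNReal.mul_rpow_of_nonneg _ _ hα, ENNReal.mul_rpow_of_nonneg _ _ hβ,
        ENNReal.mul_rpow_of_nonneg _ _ hγ]
      ring
    _ = _ := by
      rw [← ENNReal.rpow_add_of_nonneg _ _ hα hβ,
        ← ENNReal.rpow_add_of_nonneg _ _ (add_nonneg hα hβ) hγ, hone, ENNReal.rpow_one,
        ← ENNReal.rpow_add_of_nonneg _ _ hα hβ, ← ENNReal.rpow_add_of_nonneg _ _ hα hγ]

/-- Young's inequality: a kernel `k i x n` whose sums over `i`, sums over `n` and integrals over `x`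
are at most `1` maps `L^q × ℓ^p` to `ℓ^r` with norm at most `1`. Here `α = 1/r`, `α + β = 1/q` and
`α + γ = 1/p`. -/
theorem sum_lintegral_kernel_rpow_le {ι : Type*} [Fintype ι] {k : ι → X → ℕ → ℝ≥0∞}
    (hf : AEMeasurable f μ) (hk : ∀ i n, Measurable fun x => k i x n)
    (hsum : ∀ i x, ∑' n, k i x n ≤ 1) (hint : ∀ i n, ∫⁻ x, k i x n ∂μ ≤ 1)
    (hι : ∀ x n, ∑ i, k i x n ≤ 1) {p q r α β γ : ℝ} (hα : 0 ≤ α) (hβ : 0 ≤ β) (hγ : 0 ≤ γ)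
    (hr0 : 0 ≤ r) (hone : α + β + γ = 1) (hq : q * (α + β) = 1)
    (hp : p * (α + γ) = 1) (hr : r * α = 1) :
    ∑ i, (∫⁻ x, f x * ∑' n, c n * k i x n ∂μ) ^ r ≤
      ((∫⁻ x, f x ^ q ∂μ) ^ (α + β) * (∑' n, c n ^ p) ^ (α + γ)) ^ r := by
  have hI : ∑ i, ∫⁻ x, f x ^ q * ∑' n, c n ^ p * k i x n ∂μ
      ≤ (∫⁻ x, f x ^ q ∂μ) * ∑' n, c n ^ p := by
    have hmeas : ∀ i, Measurable fun x => ∑' n, c n ^ p * k i x n := fun i =>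
      Measurable.tsum fun n => (hk i n).const_mul _
    have hprod : ∀ i ∈ Finset.univ,
        AEMeasurable (fun x => f x ^ q * ∑' n, c n ^ p * k i x n) μ := fun i _ =>
      (hf.pow_const q).mul (hmeas i).aemeasurable
    rw [← lintegral_finsetSum' _ hprod, ← lintegral_mul_const'' _ (hf.pow_const q)]
    gcongr with x
    rw [← Finset.mul_sum, ← Summable.tsum_finsetSum fun i _ => ENNReal.summable]
    gcongr with n
    rw [← Finset.mul_sum]
    exact mul_le_of_le_one_right' (hι x n)
  set P := ∫⁻ x, f x ^ q ∂μ
  set Q := ∑' n, c n ^ p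
  calc ∑ i, (∫⁻ x, f x * ∑' n, c n * k i x n ∂μ) ^ r
      ≤ ∑ i, ((∫⁻ x, f x ^ q * ∑' n, c n ^ p * k i x n ∂μ) ^ α * (P ^ β * Q ^ γ)) ^ r := by
        gcongr with i
        simpa only [one_mul] using lintegral_kernel_le_holder (c := c) hf (hk i) (hsum i) (hint i)
          hα hβ hγ hone hq hp
    _ = (∑ i, ∫⁻ x, f x ^ q * ∑' n, c n ^ p * k i x n ∂μ) * (P ^ β * Q ^ γ) ^ r := by
        rw [Finset.sum_mul]
        refine Finset.sum_congr rfl fun i _ => ?_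
        rw [ENNReal.mul_rpow_of_nonneg _ _ hr0, ← ENNReal.rpow_mul, mul_comm α, hr,
          ENNReal.rpow_one]
    _ ≤ (P * Q) * (P ^ β * Q ^ γ) ^ r := by gcongr
    _ = ((P ^ α * P ^ β) * (Q ^ α * Q ^ γ)) ^ r := by
        have : (P * Q) = (P ^ α * Q ^ α) ^ r := by
          rw [← ENNReal.mul_rpow_of_nonneg _ _ hα, ← ENNReal.rpow_mul, mul_comm α, hr,
            ENNReal.rpow_one]
        rw [this, ← ENNReal.mul_rpow_of_nonneg _ _ hr0]
        ring_nf
    _ = _ := by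
        rw [← ENNReal.rpow_add_of_nonneg _ _ hα hβ, ← ENNReal.rpow_add_of_nonneg _ _ hα hγ]

end Kernel

section YoungExponents

/-- The exponents `α = 1/r`, `β = 1/q - 1/r = 1 - 1/p` and `γ = 1/p - 1/r = 1 - 1/q` of Hölder's
inequality in the proof of Young's inequality. -/
theorem exists_young_exponents {p q r : ℝ≥0∞} (hp : 1 ≤ p) (hq : 1 ≤ q) (hr : 1 ≤ r)
    (hp_top : p ≠ ∞) (hq_top : q ≠ ∞) (hpqr : 1 / p + 1 / q = 1 + 1 / r) :
    ∃ α β γ : ℝ, 0 ≤ α ∧ 0 ≤ β ∧ 0 ≤ γ ∧ α + β + γ = 1 ∧ α + β = 1 / q.toReal ∧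
      α + γ = 1 / p.toReal ∧ α = 1 / r.toReal := by
  have hfin : ∀ {s : ℝ≥0∞}, 1 ≤ s → 1 / s ≠ ∞ := fun {s} hs => by
    rw [one_div]; exact ENNReal.inv_ne_top.2 (zero_lt_one.trans_le hs).ne'
  have hle : ∀ {s : ℝ≥0∞}, 1 ≤ s → s ≠ ∞ → 1 / s.toReal ≤ 1 := fun {s} hs hs' => by
    have h1 : 1 ≤ s.toReal := by simpa using ENNReal.toReal_mono hs' hs
    rw [div_le_one (by linarith)]; exact h1
  have key := congrArg ENNReal.toReal hpqr
  rw [ENNReal.toReal_add (hfin hp) (hfin hq), ENNReal.toReal_add ENNReal.one_ne_top (hfin hr),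
    ENNReal.toReal_div, ENNReal.toReal_div, ENNReal.toReal_div, ENNReal.toReal_one] at key
  have h1 := hle hp hp_top
  have h2 := hle hq hq_top
  exact ⟨1 / r.toReal, 1 - 1 / p.toReal, 1 - 1 / q.toReal, by positivity, by linarith,
    by linarith, by linarith, by linarith, by linarith, rfl⟩

/-- The endpoint `q = ∞` of Young's inequality. -/
theorem eq_one_of_young_of_eq_top {p q r : ℝ≥0∞} (hp : 1 ≤ p) (hq : q = ∞)
    (hpqr : 1 / p + 1 / q = 1 + 1 / r) : p = 1 ∧ r = ∞ := by
  subst hq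
  rw [ENNReal.div_top, add_zero] at hpqr
  have h1 : 1 / p ≤ 1 := by rw [one_div]; exact ENNReal.inv_le_one.2 hp
  have h2 : 1 / p = 1 := le_antisymm h1 (hpqr ▸ le_self_add)
  refine ⟨by simpa using h2, ?_⟩
  rw [h2] at hpqr
  have h3 : 1 / r = 0 := by
    have : (1 : ℝ≥0∞) + 0 = 1 + 1 / r := by rw [add_zero]; exact hpqr
    exact ((ENNReal.add_right_inj ENNReal.one_ne_top).1 this).symm
  simpa using h3

variable {X : Type*} [MeasurableSpace X] {μ : Measure X} {f : X → ℂ} {c : ℕ → ℝ≥0∞}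

theorem eLpNorm_eq_lintegral_rpow_toReal {q : ℝ≥0∞} (hq : 1 ≤ q) (hq_top : q ≠ ∞) :
    eLpNorm f q μ = (∫⁻ x, ‖f x‖ₑ ^ q.toReal ∂μ) ^ (1 / q.toReal) :=
  eLpNorm_eq_lintegral_rpow_enorm_toReal (zero_lt_one.trans_le hq).ne' hq_top

theorem toReal_mul_one_div_toReal {s : ℝ≥0∞} (hs : 1 ≤ s) (hs' : s ≠ ∞) :
    s.toReal * (1 / s.toReal) = 1 :=
  mul_one_div_cancel (ENNReal.toReal_pos (zero_lt_one.trans_le hs).ne' hs').ne'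

/-- `lintegral_kernel_le` in terms of `L^q` and `ℓ^p` norms. For `q = ∞`, which forces `p = 1` and
`r = ∞`, the essential supremum of `f` is taken out of the integral instead. -/
theorem lintegral_kernel_le_eLpNorm {p q r : ℝ≥0∞} (hp : 1 ≤ p) (hq : 1 ≤ q) (hr : 1 ≤ r)
    (hp_top : p ≠ ∞) (hpqr : 1 / p + 1 / q = 1 + 1 / r) (hf : AEStronglyMeasurable f μ)
    {k : X → ℕ → ℝ≥0∞} {A : ℝ≥0∞} (hk : ∀ n, Measurable fun x => k x n)
    (hsum : ∀ x, ∑' n, k x n ≤ A) (hint : ∀ n, ∫⁻ x, k x n ∂μ ≤ A) :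
    ∫⁻ x, ‖f x‖ₑ * ∑' n, c n * k x n ∂μ ≤
      A * (eLpNorm f q μ * (∑' n, c n ^ p.toReal) ^ (1 / p.toReal)) := by
  by_cases hq_top : q = ∞
  · obtain ⟨rfl, rfl⟩ := eq_one_of_young_of_eq_top hp hq_top hpqr
    subst hq_top
    simp only [ENNReal.toReal_one, ENNReal.rpow_one, div_one, eLpNorm_exponent_top]
    calc ∫⁻ x, ‖f x‖ₑ * ∑' n, c n * k x n ∂μ
        ≤ ∫⁻ x, eLpNormEssSup f μ * ∑' n, c n * k x n ∂μ := by
          refine lintegral_mono_ae ?_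
          filter_upwards [enorm_ae_le_eLpNormEssSup f μ] with x hx
          gcongr
      _ = eLpNormEssSup f μ * ∑' n, c n * ∫⁻ x, k x n ∂μ := by
          rw [lintegral_const_mul _ (Measurable.tsum fun n => (hk n).const_mul _),
            lintegral_tsum fun n => ((hk n).const_mul _).aemeasurable]
          congr 1
          exact tsum_congr fun n => lintegral_const_mul _ (hk n)
      _ ≤ eLpNormEssSup f μ * ∑' n, c n * A := by gcongr with n; exact hint n
      _ = _ := by rw [ENNReal.tsum_mul_right]; ring
  · obtain ⟨α, β, γ, hα, hβ, hγ, hone, hqe, hpe, -⟩ :=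
      exists_young_exponents hp hq hr hp_top hq_top hpqr
    rw [eLpNorm_eq_lintegral_rpow_toReal hq hq_top, ← hqe, ← hpe]
    exact lintegral_kernel_le hf.enorm hk hsum hint hα hβ hγ hone
      (hqe ▸ toReal_mul_one_div_toReal hq hq_top) (hpe ▸ toReal_mul_one_div_toReal hp hp_top)

/-- `sum_lintegral_kernel_rpow_le` in terms of `L^q` and `ℓ^p` norms. -/
theorem sum_lintegral_kernel_rpow_le_eLpNorm {p q r : ℝ≥0∞} (hp : 1 ≤ p) (hq : 1 ≤ q) (hr : 1 ≤ r)
    (hp_top : p ≠ ∞) (hr_top : r ≠ ∞) (hpqr : 1 / p + 1 / q = 1 + 1 / r)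
    (hf : AEStronglyMeasurable f μ) {ι : Type*} [Fintype ι]
    {k : ι → X → ℕ → ℝ≥0∞} (hk : ∀ i n, Measurable fun x => k i x n)
    (hsum : ∀ i x, ∑' n, k i x n ≤ 1) (hint : ∀ i n, ∫⁻ x, k i x n ∂μ ≤ 1)
    (hι : ∀ x n, ∑ i, k i x n ≤ 1) :
    ∑ i, (∫⁻ x, ‖f x‖ₑ * ∑' n, c n * k i x n ∂μ) ^ r.toReal ≤
      (eLpNorm f q μ * (∑' n, c n ^ p.toReal) ^ (1 / p.toReal)) ^ r.toReal := by
  have hq_top : q ≠ ∞ := fun h => hr_top (eq_one_of_young_of_eq_top hp h hpqr).2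
  obtain ⟨α, β, γ, hα, hβ, hγ, hone, hqe, hpe, hre⟩ :=
    exists_young_exponents hp hq hr hp_top hq_top hpqr
  rw [eLpNorm_eq_lintegral_rpow_toReal hq hq_top, ← hqe, ← hpe]
  exact sum_lintegral_kernel_rpow_le hf.enorm hk hsum hint hι hα hβ hγ ENNReal.toReal_nonneg hone
    (hqe ▸ toReal_mul_one_div_toReal hq hq_top) (hpe ▸ toReal_mul_one_div_toReal hp hp_top)
    (hre ▸ toReal_mul_one_div_toReal hr hr_top)

end YoungExponents

/-! ### Schatten norms by testing against orthonormal families -/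

section Schatten

section Compact

variable {H : Type*} [NormedAddCommGroup H] [InnerProductSpace ℂ H]

/-- Appending a unit vector orthogonal to an orthonormal family. -/
theorem orthonormal_finCons {n : ℕ} {e : Fin n → H} (he : Orthonormal ℂ e) {u : H} (hu : ‖u‖ = 1)
    (hue : ∀ i, ⟪e i, u⟫_ℂ = 0) : Orthonormal ℂ (Fin.cons u e : Fin (n + 1) → H) := by
  refine ⟨fun i => ?_, fun i j hij => ?_⟩
  · refine Fin.cases ?_ (fun i => ?_) i
    · simpa using hu
    · simpa using he.1 i
  · induction i using Fin.cases with
    | zero =>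
      induction j using Fin.cases with
      | zero => exact absurd rfl hij
      | succ j => simpa using inner_eq_zero_symm.1 (hue j)
    | succ i =>
      induction j using Fin.cases with
      | zero => simpa using hue i
      | succ j => simpa using he.2 (i := i) (j := j) (by simpa using hij)

theorem isCompactOperator_of_finiteDimensional_range {T : H →L[ℂ] H}
    [FiniteDimensional ℂ (LinearMap.range (T : H →ₗ[ℂ] H))] : IsCompactOperator T := by
  have := FiniteDimensional.proper_rclike ℂ (LinearMap.range (T : H →ₗ[ℂ] H))
  have : IsCompactOperator (T.codRestrict (LinearMap.range (T : H →ₗ[ℂ] H)) fun x => ⟨x, rfl⟩) :=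
    isCompactOperator_of_locallyCompactSpace_dom _
  exact this.clm_comp (Submodule.subtypeL _)

/-- If `T` is at distance at least `ε` from the finite-rank operators, then it has arbitrarily large
matrices all of whose diagonal entries are at least `ε / 2` in absolute value: after `n` steps, cut
off the vectors found so far on both sides, which changes `T` by a finite-rank operator only. -/
theorem exists_orthonormal_of_dist_finiteRank {T : H →L[ℂ] H} {ε : ℝ} (hε : 0 < ε)
    (hT : ∀ K : H →L[ℂ] H, FiniteDimensional ℂ (LinearMap.range (K : H →ₗ[ℂ] H)) → ε ≤ ‖T - K‖)
    (n : ℕ) : ∃ e g : Fin n → H, Orthonormal ℂ e ∧ Orthonormal ℂ g ∧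
      ∀ i, ε / 2 ≤ ‖⟪g i, T (e i)⟫_ℂ‖ := by
  induction n with
  | zero => exact ⟨Fin.elim0, Fin.elim0, (by simp), (by simp), fun i => i.elim0⟩
  | succ n ih =>
    obtain ⟨e, g, he, hg, heg⟩ := ih
    let U := Submodule.span ℂ (Set.range e)
    let W := Submodule.span ℂ (Set.range g)
    have hUf : FiniteDimensional ℂ U := FiniteDimensional.span_of_finite ℂ (Set.finite_range e)
    have hWf : FiniteDimensional ℂ W := FiniteDimensional.span_of_finite ℂ (Set.finite_range g)
    let P := U.starProjection
    let Q := W.starProjection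
    -- the finite-rank operator `K` is chosen so that `T - K = (1 - Q) T (1 - P)`
    let K : H →L[ℂ] H := T ∘L P + Q ∘L (T - T ∘L P)
    have hP : FiniteDimensional ℂ (LinearMap.range (P : H →ₗ[ℂ] H)) := by
      rw [show LinearMap.range (P : H →ₗ[ℂ] H) = U from U.range_starProjection]; infer_instance
    have hQ : FiniteDimensional ℂ (LinearMap.range (Q : H →ₗ[ℂ] H)) := by
      rw [show LinearMap.range (Q : H →ₗ[ℂ] H) = W from W.range_starProjection]; infer_instance
    have hK : FiniteDimensional ℂ (LinearMap.range (K : H →ₗ[ℂ] H)) := by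
      have hle : LinearMap.range (K : H →ₗ[ℂ] H) ≤
          (LinearMap.range (P : H →ₗ[ℂ] H)).map (T : H →ₗ[ℂ] H) ⊔
            LinearMap.range (Q : H →ₗ[ℂ] H) := by
        rintro _ ⟨x, rfl⟩
        exact Submodule.add_mem_sup ⟨P x, ⟨x, rfl⟩, rfl⟩ ⟨(T - T ∘L P) x, rfl⟩
      exact Submodule.finiteDimensional_of_le hle
    have hdist := hT K hK
    obtain ⟨x, hx⟩ : ∃ x, ε / 2 * ‖x‖ < ‖(T - K) x‖ := by
      by_contra! hcon
      have := (T - K).opNorm_le_bound (by positivity) hcon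
      linarith
    set y := (T - K) x with hy
    set x' := x - P x with hx'
    have hyW : y ∈ Wᗮ := by
      have : y = T x' - Q (T x') := by simp [hy, K, hx', sub_sub]
      rw [this]; exact W.sub_starProjection_mem_orthogonal _
    have hxU : x' ∈ Uᗮ := U.sub_starProjection_mem_orthogonal x
    have hxle : ‖x'‖ ≤ ‖x‖ := by
      have h1 := U.norm_sq_eq_add_norm_sq_starProjection x
      have h2 : ‖Uᗮ.starProjection x‖ = ‖x'‖ := by
        rw [Submodule.starProjection_orthogonal_val]
      rw [h2] at h1
      have := sq_nonneg ‖U.starProjection x‖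
      exact le_of_sq_le_sq (by linarith) (norm_nonneg _)
    have hy0 : 0 < ‖y‖ := lt_of_le_of_lt (by positivity) hx
    have hTx' : ⟪y, T x'⟫_ℂ = ⟪y, y⟫_ℂ := by
      have : T x' = y + Q (T x') := by simp [hy, K, hx']; abel
      rw [this, inner_add_right, (Submodule.mem_orthogonal' _ _).1 hyW _
        (W.starProjection_apply_mem _), add_zero]
    have hx'0 : 0 < ‖x'‖ := by
      rw [norm_pos_iff]
      intro h0
      rw [h0, map_zero, inner_zero_right] at hTx'
      exact (norm_pos_iff.1 hy0) (inner_self_eq_zero.1 hTx'.symm)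
    let u : H := ((‖x'‖⁻¹ : ℝ) : ℂ) • x'
    let v : H := ((‖y‖⁻¹ : ℝ) : ℂ) • y
    refine ⟨Fin.cons u e, Fin.cons v g, orthonormal_finCons he ?_ ?_,
      orthonormal_finCons hg ?_ ?_, ?_⟩
    · simp [u, norm_smul, hx'0.ne']
    · intro i
      rw [inner_smul_right, (Submodule.mem_orthogonal _ _).1 hxU _
        (Submodule.subset_span ⟨i, rfl⟩), mul_zero]
    · simp [v, norm_smul, hy0.ne']
    · intro i
      rw [inner_smul_right, (Submodule.mem_orthogonal _ _).1 hyW _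
        (Submodule.subset_span ⟨i, rfl⟩), mul_zero]
    · intro i
      induction i using Fin.cases with
      | zero =>
        simp only [Fin.cons_zero, u, v, map_smul, inner_smul_left, inner_smul_right, hTx',
          norm_mul, Complex.conj_ofReal, Complex.norm_real, norm_inv, norm_norm,
          inner_self_eq_norm_sq_to_K]
        simp only [norm_pow, RCLike.norm_ofReal, abs_norm]
        have h3 : ε / 2 * ‖x'‖ ≤ ‖y‖ := (mul_le_mul_of_nonneg_left hxle (by positivity)).trans hx.le
        calc ε / 2 ≤ ‖x'‖⁻¹ * ‖y‖ := by rw [inv_mul_eq_div, le_div_iff₀ hx'0]; exact h3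
          _ = _ := by field_simp
      | succ i => simpa using heg i

variable [CompleteSpace H]

/-- Testing on finite orthonormal families: if `∑ |⟨T eᵢ, gᵢ⟩|^r ≤ C^r` for all finite orthonormal
families `e` and `g`, then `T` is compact. -/
theorem isCompactOperator_of_sum_inner_le {r : ℝ} (hr : 0 < r) {T : H →L[ℂ] H} {C : ℝ≥0∞}
    (hC : C ≠ ∞) (h : ∀ (n : ℕ) (e g : Fin n → H), Orthonormal ℂ e → Orthonormal ℂ g →
      ∑ i, ‖⟪g i, T (e i)⟫_ℂ‖ₑ ^ r ≤ C ^ r) : IsCompactOperator T := by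
  have hcl := isClosed_setOfPred_isCompactOperator (σ₁₂ := RingHom.id ℂ) (M₁ := H) (M₂ := H)
  refine hcl.closure_subset (Metric.mem_closure_iff.2 fun ε hε => ?_)
  by_contra! hcon
  have hdist : ∀ K : H →L[ℂ] H, FiniteDimensional ℂ (LinearMap.range (K : H →ₗ[ℂ] H)) →
      ε ≤ ‖T - K‖ := fun K hK => by
    rw [← dist_eq_norm]; exact hcon K (isCompactOperator_of_finiteDimensional_range)
  have hb : ∀ n : ℕ, (n : ℝ≥0∞) * ENNReal.ofReal (ε / 2) ^ r ≤ C ^ r := fun n => by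
    obtain ⟨e, g, he, hg, heg⟩ := exists_orthonormal_of_dist_finiteRank hε hdist n
    refine le_trans ?_ (h n e g he hg)
    have hcard : (n : ℝ≥0∞) * ENNReal.ofReal (ε / 2) ^ r
        = ∑ _i : Fin n, ENNReal.ofReal (ε / 2) ^ r := by simp
    rw [hcard]
    gcongr with i
    rw [← ofReal_norm]
    exact ENNReal.ofReal_le_ofReal (heg i)
  have hδ : ENNReal.ofReal (ε / 2) ^ r ≠ 0 := by
    simp [ENNReal.rpow_eq_zero_iff, hr, hε]
  have hCr : C ^ r ≠ ∞ := ENNReal.rpow_ne_top_of_nonneg hr.le hC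
  obtain ⟨n, hn⟩ := ENNReal.exists_nat_mul_gt hδ hCr
  exact absurd (hb n) (not_le.2 hn)

/-- Normalized images of orthonormal eigenvectors of `T*T` are orthonormal. -/
theorem orthonormal_smul_image {ι : Type*} {T : H →L[ℂ] H} {e : ι → H} {σ : ι → ℝ}
    (hσ : ∀ j, 0 < σ j) (he : Orthonormal ℂ e)
    (heig : ∀ j, ContinuousLinearMap.adjoint T (T (e j)) = ((σ j ^ 2 : ℝ) : ℂ) • e j) :
    Orthonormal ℂ fun j => (((σ j)⁻¹ : ℝ) : ℂ) • T (e j) := by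
  classical
  rw [orthonormal_iff_ite]
  intro i j
  rw [inner_smul_left, inner_smul_right, ← ContinuousLinearMap.adjoint_inner_right, heig,
    inner_smul_right, orthonormal_iff_ite.1 he]
  split_ifs with h
  · subst h
    have := (hσ i).ne'
    rw [Complex.conj_ofReal, mul_one]
    norm_cast
    field_simp
  · simp

theorem isSymmetric_adjoint_comp_self (T : H →L[ℂ] H) :
    ((ContinuousLinearMap.adjoint T ∘L T : H →L[ℂ] H) : H →ₗ[ℂ] H).IsSymmetric := fun x y => by
  simp [ContinuousLinearMap.adjoint_inner_left, ContinuousLinearMap.adjoint_inner_right]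

/-- The kernel of a compact operator `T` is the orthogonal complement of the eigenspaces of `T*T`
with positive eigenvalues. -/
theorem apply_eq_zero_of_orthogonal_eigenspaces {T : H →L[ℂ] H} (hT : IsCompactOperator T) {x : H}
    (hx : ∀ s : ℝ, 0 < s → ∀ v ∈ Module.End.eigenspace
      ((ContinuousLinearMap.adjoint T ∘L T : H →L[ℂ] H) : H →ₗ[ℂ] H) ((s ^ 2 : ℝ) : ℂ),
      ⟪v, x⟫_ℂ = 0) : T x = 0 := by
  set A : H →L[ℂ] H := ContinuousLinearMap.adjoint T ∘L T with hA
  have hAx : ∀ x, A x = ContinuousLinearMap.adjoint T (T x) := fun x => rfl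
  have hsymm : (A : H →ₗ[ℂ] H).IsSymmetric := isSymmetric_adjoint_comp_self T
  have hcomp : IsCompactOperator A := hT.clm_comp (ContinuousLinearMap.adjoint T)
  -- `A x` is orthogonal to every eigenspace of `A`
  have hAx0 : A x = 0 := by
    have hbot := ContinuousLinearMap.orthogonalComplement_iSup_eigenspaces_eq_bot hcomp hsymm
    rw [← Submodule.mem_bot ℂ, ← hbot, Submodule.mem_orthogonal]
    intro v hv
    induction hv using Submodule.iSup_induction' with
    | zero => simp
    | add v w _ _ hv hw => rw [inner_add_left, hv, hw, add_zero]
    | mem μ v hv =>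
      have hv' : A v = μ • v := Module.End.mem_eigenspace_iff.1 hv
      have h1 : ⟪v, A x⟫_ℂ = (starRingEnd ℂ) μ * ⟪v, x⟫_ℂ := by
        rw [← inner_smul_left, ← hv']; exact (hsymm v x).symm
      rw [h1]
      by_cases hTv : T v = 0
      · rw [← h1, hAx, ContinuousLinearMap.adjoint_inner_right, hTv, inner_zero_left]
      have hv0 : v ≠ 0 := fun h => hTv (by rw [h, map_zero])
      have hvn : 0 < ‖v‖ := norm_pos_iff.2 hv0
      have hμ : μ * (‖v‖ : ℂ) ^ 2 = (‖T v‖ : ℂ) ^ 2 := by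
        have h2 : ⟪v, A v⟫_ℂ = ⟪T v, T v⟫_ℂ := by
          rw [hAx, ContinuousLinearMap.adjoint_inner_right]
        rw [hv', inner_smul_right, inner_self_eq_norm_sq_to_K, inner_self_eq_norm_sq_to_K] at h2
        exact h2
      have hpos : 0 < ‖T v‖ / ‖v‖ := div_pos (norm_pos_iff.2 hTv) hvn
      have hμ' : μ = (((‖T v‖ / ‖v‖) ^ 2 : ℝ) : ℂ) := by
        have : (‖v‖ : ℂ) ≠ 0 := by exact_mod_cast hvn.ne'
        push_cast
        rw [div_pow, ← hμ]
        field_simp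
      rw [hx _ hpos v (by rw [← hμ']; exact hv), mul_zero]
  have h3 : ⟪T x, T x⟫_ℂ = 0 := by
    rw [← ContinuousLinearMap.adjoint_inner_right, ← hAx, hAx0, inner_zero_right]
  exact inner_self_eq_zero.1 h3

/-- The spectral theorem for `T*T`, with orthonormal bases of the eigenspaces for positive
eigenvalues collected in one orthonormal family. -/
theorem exists_orthonormal_eigenvectors_adjoint_comp_self {T : H →L[ℂ] H}
    (hT : IsCompactOperator T) :
    ∃ e : (Σ s : {s : ℝ // 0 < s}, Fin (Module.finrank ℂ (Module.End.eigenspace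
        ((ContinuousLinearMap.adjoint T ∘L T : H →L[ℂ] H) : H →ₗ[ℂ] H)
        (((s : ℝ) ^ 2 : ℝ) : ℂ)))) → H,
      Orthonormal ℂ e ∧
      (∀ j, ContinuousLinearMap.adjoint T (T (e j)) = (((j.1 : ℝ) ^ 2 : ℝ) : ℂ) • e j) ∧
      ∀ x, (∀ j, ⟪e j, x⟫_ℂ = 0) → T x = 0 := by
  set A : H →L[ℂ] H := ContinuousLinearMap.adjoint T ∘L T with hA
  have hsymm : (A : H →ₗ[ℂ] H).IsSymmetric := isSymmetric_adjoint_comp_self T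
  have hcomp : IsCompactOperator A := hT.clm_comp (ContinuousLinearMap.adjoint T)
  let E : {s : ℝ // 0 < s} → Submodule ℂ H := fun t =>
    Module.End.eigenspace (A : H →ₗ[ℂ] H) (((t : ℝ) ^ 2 : ℝ) : ℂ)
  have hE : OrthogonalFamily ℂ (fun t => E t) fun t => (E t).subtypeₗᵢ := by
    refine hsymm.orthogonalFamily_eigenspaces.comp
      (f := fun t : {s : ℝ // 0 < s} => (((t : ℝ) ^ 2 : ℝ) : ℂ)) fun a b hab => ?_
    have h1 : (a : ℝ) ^ 2 = (b : ℝ) ^ 2 := Complex.ofReal_injective hab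
    exact Subtype.ext ((pow_left_inj₀ a.2.le b.2.le two_ne_zero).1 h1)
  have hfin : ∀ t, FiniteDimensional ℂ (E t) := fun t =>
    ContinuousLinearMap.finite_dimensional_eigenspace hcomp _ (by simpa using t.2.ne')
  let b : ∀ t, OrthonormalBasis (Fin (Module.finrank ℂ (E t))) ℂ (E t) := fun t =>
    stdOrthonormalBasis ℂ (E t)
  refine ⟨fun j => (b j.1 j.2 : H),
    hE.orthonormal_sigma_orthonormal fun t => (b t).orthonormal,
    fun j => Module.End.mem_eigenspace_iff.1 (b j.1 j.2).2,
    fun x hx => apply_eq_zero_of_orthogonal_eigenspaces hT fun t ht v hv => ?_⟩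
  have h1 := congrArg (fun w : E ⟨t, ht⟩ => ⟪(w : H), x⟫_ℂ) ((b ⟨t, ht⟩).sum_repr ⟨v, hv⟩)
  simp only [AddSubmonoidClass.coe_finsetSum, Submodule.coe_smul, sum_inner,
    inner_smul_left] at h1
  rw [← h1]
  exact Finset.sum_eq_zero fun i _ => by rw [hx ⟨⟨t, ht⟩, i⟩, mul_zero]

end Compact

variable {d : ℕ}

/-- The index set of the singular values of `T`, counted with multiplicity. -/
abbrev SingularIndex (T : L2 d →L[ℂ] L2 d) : Type :=
  Σ s : {s : ℝ // 0 < s}, Fin (singularMult T s)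

/-- Orthonormal eigenvectors of `T*T`, one for each singular value of `T`. -/
theorem exists_singular_system {T : L2 d →L[ℂ] L2 d} (hT : IsCompactOperator T) :
    ∃ e : SingularIndex T → L2 d, Orthonormal ℂ e ∧
      (∀ j, ContinuousLinearMap.adjoint T (T (e j)) = (((j.1 : ℝ) ^ 2 : ℝ) : ℂ) • e j) ∧
      ∀ x, (∀ j, ⟪e j, x⟫_ℂ = 0) → T x = 0 :=
  exists_orthonormal_eigenvectors_adjoint_comp_self hT

/-- Testing on finite orthonormal families bounds the Schatten norm: eigenvectors of `S*S` and their
normalized images under `S` are orthonormal families with `⟨S eᵢ, gᵢ⟩` the singular values. -/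
theorem schattenNorm_le_of_sum_inner_le {r : ℝ≥0∞} (hr : 1 ≤ r) (hr' : r ≠ ∞)
    {T : L2 d →L[ℂ] L2 d} {C : ℝ≥0∞} (hC : C ≠ ∞)
    (h : ∀ (ι : Type) [Fintype ι] (e g : ι → L2 d), Orthonormal ℂ e → Orthonormal ℂ g →
      ∑ i, ‖⟪g i, T (e i)⟫_ℂ‖ₑ ^ r.toReal ≤ C ^ r.toReal) : schattenNorm r T ≤ C := by
  have hr0 : 0 < r.toReal := ENNReal.toReal_pos (zero_lt_one.trans_le hr).ne' hr'
  have hcomp : IsCompactOperator T :=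
    isCompactOperator_of_sum_inner_le hr0 hC fun n e g he hg => h (Fin n) e g he hg
  rw [schattenNorm, if_neg hr', if_pos hcomp, one_div, ENNReal.rpow_inv_le_iff hr0,
    ENNReal.tsum_eq_iSup_sum]
  refine iSup_le fun s => ?_
  obtain ⟨e, he, heig, -⟩ := exists_singular_system hcomp
  let φ : (Σ t : s, Fin (singularMult T (t : {s : ℝ // 0 < s}))) → SingularIndex T :=
    fun a => ⟨a.1, a.2⟩
  have hφ : Function.Injective φ := by
    rintro ⟨⟨t, ht⟩, i⟩ ⟨⟨t', ht'⟩, i'⟩ hab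
    simp only [φ, Sigma.mk.injEq] at hab
    obtain ⟨rfl, hab⟩ := hab
    simpa using hab
  have hg := (orthonormal_smul_image (fun j : SingularIndex T => j.1.2) he heig).comp φ hφ
  refine le_trans (le_of_eq ?_) (h _ (e ∘ φ) _ (he.comp φ hφ) hg)
  rw [Fintype.sum_sigma, ← Finset.sum_coe_sort]
  refine Finset.sum_congr rfl fun t _ => ?_
  have hval : ∀ i : Fin (singularMult T (t : {s : ℝ // 0 < s})),
      ‖⟪((((φ ⟨t, i⟩).1 : ℝ)⁻¹ : ℝ) : ℂ) • T (e (φ ⟨t, i⟩)), T (e (φ ⟨t, i⟩))⟫_ℂ‖ₑ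
        = ENNReal.ofReal (t : {s : ℝ // 0 < s}) := fun i => by
    have ht := (t : {s : ℝ // 0 < s}).2
    rw [inner_smul_left, ← ContinuousLinearMap.adjoint_inner_right,
      show ContinuousLinearMap.adjoint T (T (e (φ ⟨t, i⟩))) = _ from heig _, inner_smul_right,
      inner_self_eq_norm_sq_to_K, he.1]
    rw [← ofReal_norm]
    congr 1
    simp only [φ, norm_mul, Complex.norm_real, Complex.conj_ofReal]
    simp [abs_of_pos ht, sq, ht.ne']
  simp only [Function.comp_apply, hval, Finset.sum_const, Finset.card_univ, Fintype.card_fin,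
    nsmul_eq_mul]

end Schatten

/-! ### Operators given by singular series -/

section Bessel

variable {H : Type*} [NormedAddCommGroup H] [InnerProductSpace ℂ H]

theorem enorm_rpow_two {E : Type*} [SeminormedAddCommGroup E] (a : E) :
    ‖a‖ₑ ^ (2 : ℝ) = ENNReal.ofReal (‖a‖ ^ 2) := by
  rw [← ofReal_norm, ENNReal.rpow_two, ENNReal.ofReal_pow (norm_nonneg _)]

theorem Orthonormal.tsum_enorm_inner_sq_le {ι : Type*} {v : ι → H} (hv : Orthonormal ℂ v) (x : H) :
    ∑' i, ‖⟪v i, x⟫_ℂ‖ₑ ^ (2 : ℝ) ≤ ‖x‖ₑ ^ (2 : ℝ) := by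
  rw [ENNReal.tsum_eq_iSup_sum]
  refine iSup_le fun s => ?_
  rw [enorm_rpow_two, Finset.sum_congr rfl fun i _ => enorm_rpow_two _,
    ← ENNReal.ofReal_sum_of_nonneg fun i _ => sq_nonneg _]
  exact ENNReal.ofReal_le_ofReal (hv.sum_inner_products_le x)

theorem enorm_eq_one_of_norm_eq_one {E : Type*} [SeminormedAddCommGroup E] {x : E} (hx : ‖x‖ = 1) :
    ‖x‖ₑ = 1 := by
  rw [← ofReal_norm, hx, ENNReal.ofReal_one]

theorem tsum_enorm_inner_mul_le {ι : Type*} {v w : ι → H} (hv : Orthonormal ℂ v)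
    (hw : Orthonormal ℂ w) (x y : H) :
    ∑' i, ‖⟪v i, x⟫_ℂ‖ₑ * ‖⟪w i, y⟫_ℂ‖ₑ ≤ ‖x‖ₑ * ‖y‖ₑ :=
  tsum_mul_le_of_tsum_sq_le (hv.tsum_enorm_inner_sq_le x) (hw.tsum_enorm_inner_sq_le y)

theorem enorm_inner_comm (x y : H) : ‖⟪x, y⟫_ℂ‖ₑ = ‖⟪y, x⟫_ℂ‖ₑ := by
  rw [← ofReal_norm, ← ofReal_norm, norm_inner_symm]

end Bessel

section SingularSeries

variable {H : Type*} [NormedAddCommGroup H] [InnerProductSpace ℂ H]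

/-- `S = ∑ₙ cₙ φ₂ₙ ⊗ φ₁ₙ`, with pointwise (strong) convergence of the series. -/
def IsSingularSeries (c : ℕ → ℂ) (φ₁ φ₂ : ℕ → H) (S : H →L[ℂ] H) : Prop :=
  ∀ ψ : H, HasSum (fun n => c n • ⟪φ₁ n, ψ⟫_ℂ • φ₂ n) (S ψ)

variable {c : ℕ → ℂ} {φ₁ φ₂ : ℕ → H} {S : H →L[ℂ] H}

theorem IsSingularSeries.hasSum_inner (hS : IsSingularSeries c φ₁ φ₂ S) (ψ η : H) :
    HasSum (fun n => c n * (⟪φ₁ n, ψ⟫_ℂ * ⟪η, φ₂ n⟫_ℂ)) ⟪η, S ψ⟫_ℂ := by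
  have := (hS ψ).mapL (innerSL ℂ η)
  simpa only [innerSL_apply_apply, inner_smul_right] using this

theorem IsSingularSeries.enorm_inner_le (hS : IsSingularSeries c φ₁ φ₂ S) (ψ η : H) :
    ‖⟪η, S ψ⟫_ℂ‖ₑ ≤ ∑' n, ‖c n‖ₑ * (‖⟪φ₁ n, ψ⟫_ℂ‖ₑ * ‖⟪φ₂ n, η⟫_ℂ‖ₑ) := by
  have h := hS.hasSum_inner ψ η
  rw [← h.tsum_eq]
  refine enorm_tsum_le_tsum_enorm.trans (le_of_eq (tsum_congr fun n => ?_))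
  rw [enorm_mul, enorm_mul, enorm_inner_comm η]

theorem isSingularSeries_single (φ₁ φ₂ : ℕ → H) (m : ℕ) (a : ℂ) :
    IsSingularSeries (Pi.single m a) φ₁ φ₂ (a • InnerProductSpace.rankOne ℂ (φ₂ m) (φ₁ m)) :=
  fun ψ => by
  have := hasSum_single (f := fun n => (Pi.single m a : ℕ → ℂ) n • ⟪φ₁ n, ψ⟫_ℂ • φ₂ n) m
    fun n hn => by simp [hn]
  simpa using this

/-- The remainder after `N` terms, with the opposite sign, is a singular series again. -/
theorem IsSingularSeries.sum_range_sub (hS : IsSingularSeries c φ₁ φ₂ S) (N : ℕ) :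
    IsSingularSeries (fun n => if n < N then 0 else -c n) φ₁ φ₂
      (∑ n ∈ Finset.range N, c n • InnerProductSpace.rankOne ℂ (φ₂ n) (φ₁ n) - S) := fun ψ => by
  have h1 : HasSum (fun n => if n < N then c n • ⟪φ₁ n, ψ⟫_ℂ • φ₂ n else 0)
      (∑ n ∈ Finset.range N, c n • ⟪φ₁ n, ψ⟫_ℂ • φ₂ n) := by
    have := hasSum_sum_of_ne_finset_zero (L := .unconditional ℕ)
      (f := fun n => if n < N then c n • ⟪φ₁ n, ψ⟫_ℂ • φ₂ n else 0) (s := Finset.range N)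
      fun n hn => if_neg (by simpa using hn)
    rwa [Finset.sum_congr rfl fun n hn => if_pos (Finset.mem_range.1 hn)] at this
  convert h1.sub (hS ψ) using 1
  · ext n
    by_cases hn : n < N <;> simp [hn]
  · simp

/-- By Bessel's inequality, `∑ cₙ φ₂ₙ ⊗ φ₁ₙ` is bounded by the supremum of the `|cₙ|`, which makes the
series converge in operator norm when `cₙ → 0`. -/
theorem norm_sum_smul_rankOne_le (hφ₁ : Orthonormal ℂ φ₁) (hφ₂ : Orthonormal ℂ φ₂) (s : Finset ℕ)
    {M : ℝ} (hM : 0 ≤ M) (hc : ∀ n ∈ s, ‖c n‖ ≤ M) :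
    ‖∑ n ∈ s, c n • InnerProductSpace.rankOne ℂ (φ₂ n) (φ₁ n)‖ ≤ M := by
  refine ContinuousLinearMap.opNorm_le_bound _ hM fun ψ => ?_
  have h1 : ‖∑ n ∈ s, (c n * ⟪φ₁ n, ψ⟫_ℂ) • φ₂ n‖ ^ 2 = ∑ n ∈ s, ‖c n * ⟪φ₁ n, ψ⟫_ℂ‖ ^ 2 := by
    simpa using hφ₂.orthogonalFamily.norm_sum (fun n => c n * ⟪φ₁ n, ψ⟫_ℂ) s
  have h2 : ‖∑ n ∈ s, (c n * ⟪φ₁ n, ψ⟫_ℂ) • φ₂ n‖ ^ 2 ≤ (M * ‖ψ‖) ^ 2 := by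
    rw [h1, mul_pow]
    refine le_trans ?_ (mul_le_mul_of_nonneg_left (hφ₁.sum_inner_products_le ψ (s := s))
      (sq_nonneg M))
    rw [Finset.mul_sum]
    refine Finset.sum_le_sum fun n hn => ?_
    rw [norm_mul, mul_pow]
    gcongr
    exact hc n hn
  simpa [_root_.sum_apply, smul_smul] using
    le_of_sq_le_sq h2 (by positivity)

variable [CompleteSpace H]

/-- Coefficients tending to zero define a singular series. -/
theorem exists_isSingularSeries (hφ₁ : Orthonormal ℂ φ₁) (hφ₂ : Orthonormal ℂ φ₂)
    (hc : Tendsto c cofinite (𝓝 0)) : ∃ S : H →L[ℂ] H, IsSingularSeries c φ₁ φ₂ S := by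
  have hsum : Summable fun n => c n • InnerProductSpace.rankOne ℂ (φ₂ n) (φ₁ n) := by
    rw [summable_iff_vanishing_norm]
    intro ε hε
    have hev : ∀ᶠ n in cofinite, ‖c n‖ < ε / 2 := by
      have := (tendsto_zero_iff_norm_tendsto_zero.1 hc).eventually (gt_mem_nhds (half_pos hε))
      exact this
    rw [eventually_cofinite] at hev
    refine ⟨hev.toFinset, fun t ht => ?_⟩
    refine lt_of_le_of_lt (norm_sum_smul_rankOne_le hφ₁ hφ₂ t (half_pos hε).le fun n hn => ?_)
      (half_lt_self hε)
    have := Finset.disjoint_left.1 ht hn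
    simp only [Set.Finite.mem_toFinset, Set.mem_ofPred_eq, not_not] at this
    exact this.le
  obtain ⟨S, hS⟩ := hsum
  refine ⟨S, fun ψ => ?_⟩
  have := hS.mapL (ContinuousLinearMap.apply ℂ H ψ)
  simpa using this

end SingularSeries

theorem tendsto_cofinite_zero_of_memℓp {c : ℕ → ℂ} {p : ℝ≥0∞} (hp : 1 ≤ p) (hp_top : p ≠ ∞)
    (hc : Memℓp c p) : Tendsto c cofinite (𝓝 0) := by
  have hp0 : 0 < p.toReal := ENNReal.toReal_pos (zero_lt_one.trans_le hp).ne' hp_top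
  have h1 := (hc.summable hp0).tendsto_cofinite_zero
  rw [tendsto_zero_iff_norm_tendsto_zero]
  have h2 := h1.rpow_const (p := 1 / p.toReal) (Or.inr (by positivity))
  simpa [← Real.rpow_mul, mul_inv_cancel₀ hp0.ne', hp0.ne'] using h2

theorem tsum_enorm_rpow_ne_top_of_memℓp {c : ℕ → ℂ} {p : ℝ≥0∞} (hp : 1 ≤ p) (hp_top : p ≠ ∞)
    (hc : Memℓp c p) : ∑' n, ‖c n‖ₑ ^ p.toReal ≠ ∞ := by
  have hp0 : 0 < p.toReal := ENNReal.toReal_pos (zero_lt_one.trans_le hp).ne' hp_top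
  have h1 := (hc.summable hp0).tsum_ofReal_ne_top
  simpa only [← ENNReal.ofReal_rpow_of_nonneg (norm_nonneg _) hp0.le, ofReal_norm] using h1

theorem tsum_enorm_single_rpow_ne_top {p : ℝ} (hp : 0 < p) (m : ℕ) (a : ℂ) :
    ∑' n, ‖(Pi.single m a : ℕ → ℂ) n‖ₑ ^ p ≠ ∞ := by
  rw [tsum_eq_single m fun n hn => by simp [hn, hp]]
  exact ENNReal.rpow_ne_top_of_nonneg hp.le enorm_ne_top

theorem tsum_tail_ne_top {c : ℕ → ℂ} {p : ℝ} (hp : 0 < p) (hc : ∑' n, ‖c n‖ₑ ^ p ≠ ∞) (N : ℕ) :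
    ∑' n, ‖if n < N then 0 else -c n‖ₑ ^ p ≠ ∞ := by
  refine ne_top_of_le_ne_top hc (ENNReal.tsum_le_tsum fun n => ?_)
  split_ifs
  · simp [hp]
  · rw [enorm_neg]

/-- The `ℓᵖ` norms of the remainders of a sequence in `ℓᵖ` tend to zero. -/
theorem tendsto_tail_lpNorm {c : ℕ → ℂ} {p : ℝ} (hp : 0 < p)
    (hc : ∑' n, ‖c n‖ₑ ^ p ≠ ∞) :
    Tendsto (fun N : ℕ => (∑' n, ‖if n < N then 0 else -c n‖ₑ ^ p) ^ (1 / p)) atTop (𝓝 0) := by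
  have h1 : ∀ N : ℕ, ∑' n, ‖if n < N then 0 else -c n‖ₑ ^ p = ∑' n, ‖c (n + N)‖ₑ ^ p := fun N => by
    have h0 : ∀ n ∈ Finset.range N, ‖if n < N then 0 else -c n‖ₑ ^ p = 0 := fun n hn => by
      rw [if_pos (Finset.mem_range.1 hn), enorm_zero, ENNReal.zero_rpow_of_pos hp]
    have h2 := Summable.sum_add_tsum_nat_add' (f := fun n => ‖if n < N then 0 else -c n‖ₑ ^ p)
      (k := N) ENNReal.summable
    rw [← h2, Finset.sum_eq_zero h0, zero_add]
    refine tsum_congr fun n => ?_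
    rw [if_neg (by omega), enorm_neg]
  simp only [h1]
  have h2 := ENNReal.tendsto_sum_nat_add (fun n => ‖c n‖ₑ ^ p) hc
  have h3 := (ENNReal.continuous_rpow_const (y := 1 / p)).continuousAt.tendsto.comp h2
  rwa [ENNReal.zero_rpow_of_pos (by positivity)] at h3

section SchattenSeries

variable {d : ℕ} {c : ℕ → ℂ} {φ₁ φ₂ : ℕ → L2 d} {S : L2 d →L[ℂ] L2 d}

/-- The Schatten norm of a singular series is at most the `ℓᵖ` norm of its coefficients: Young's
inequality on a one-point space. -/
theorem IsSingularSeries.schattenNorm_le (hS : IsSingularSeries c φ₁ φ₂ S)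
    (hφ₁ : Orthonormal ℂ φ₁) (hφ₂ : Orthonormal ℂ φ₂) {p : ℝ≥0∞} (hp : 1 ≤ p) (hp_top : p ≠ ∞)
    (hc : ∑' n, ‖c n‖ₑ ^ p.toReal ≠ ∞) :
    schattenNorm p S ≤ (∑' n, ‖c n‖ₑ ^ p.toReal) ^ (1 / p.toReal) := by
  refine schattenNorm_le_of_sum_inner_le hp hp_top
    (ENNReal.rpow_ne_top_of_nonneg (by positivity) hc) fun ι _ e g he hg => ?_
  have hsum : ∀ x y, ‖x‖ = 1 → ‖y‖ = 1 →
      ∑' n, ‖⟪φ₁ n, x⟫_ℂ‖ₑ * ‖⟪φ₂ n, y⟫_ℂ‖ₑ ≤ 1 := fun x y hx hy => by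
    simpa [enorm_eq_one_of_norm_eq_one hx, enorm_eq_one_of_norm_eq_one hy] using
      tsum_enorm_inner_mul_le hφ₁ hφ₂ x y
  have key := sum_lintegral_kernel_rpow_le_eLpNorm (μ := Measure.dirac ()) (f := fun _ => 1)
    (c := fun n => ‖c n‖ₑ) (q := 1) (k := fun i _ n => ‖⟪φ₁ n, e i⟫_ℂ‖ₑ * ‖⟪φ₂ n, g i⟫_ℂ‖ₑ)
    hp le_rfl hp hp_top hp_top (by rw [div_one, add_comm]) aestronglyMeasurable_const
    (fun _ _ => measurable_const) (fun i _ => hsum _ _ (he.1 i) (hg.1 i))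
    (fun i n => by
      simpa using (ENNReal.le_tsum n).trans (hsum _ _ (he.1 i) (hg.1 i)))
    (fun _ n => by
      rw [← tsum_fintype (L := .unconditional _)]
      simpa [enorm_inner_comm, enorm_eq_one_of_norm_eq_one (hφ₁.1 n),
        enorm_eq_one_of_norm_eq_one (hφ₂.1 n)] using tsum_enorm_inner_mul_le he hg (φ₁ n) (φ₂ n))
  simp only [lintegral_dirac, enorm_one, one_mul] at key
  refine le_trans ?_ (key.trans (le_of_eq ?_))
  · gcongr with i
    exact hS.enorm_inner_le _ _
  · simp

/-- A singular series with coefficients in `ℓᵖ` converges in the norm of `𝒯ᵖ`. -/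
theorem IsSingularSeries.hasSchattenSum (hS : IsSingularSeries c φ₁ φ₂ S)
    (hφ₁ : Orthonormal ℂ φ₁) (hφ₂ : Orthonormal ℂ φ₂) {p : ℝ≥0∞} (hp : 1 ≤ p) (hp_top : p ≠ ∞)
    (hc : ∑' n, ‖c n‖ₑ ^ p.toReal ≠ ∞) :
    HasSchattenSum p (fun n => c n • rankOneOp (φ₂ n) (φ₁ n)) S := by
  have hp0 : 0 < p.toReal := ENNReal.toReal_pos (zero_lt_one.trans_le hp).ne' hp_top
  have hmem : ∀ {c' : ℕ → ℂ} {T : L2 d →L[ℂ] L2 d}, IsSingularSeries c' φ₁ φ₂ T →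
      ∑' n, ‖c' n‖ₑ ^ p.toReal ≠ ∞ → MemSchatten p T := fun hT hc' =>
    (hT.schattenNorm_le hφ₁ hφ₂ hp hp_top hc').trans_lt
      (ENNReal.rpow_lt_top_of_nonneg (by positivity) hc')
  refine ⟨fun n => hmem (isSingularSeries_single φ₁ φ₂ n (c n))
    (tsum_enorm_single_rpow_ne_top hp0 n (c n)), hmem hS hc, ?_⟩
  refine tendsto_of_tendsto_of_tendsto_of_le_of_le tendsto_const_nhds
    (tendsto_tail_lpNorm hp0 hc) (fun _ => zero_le) fun N => ?_
  exact (hS.sum_range_sub N).schattenNorm_le hφ₁ hφ₂ hp hp_top (tsum_tail_ne_top hp0 hc N)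

end SchattenSeries

/-! ### Convolutions of functions with operators -/

section Convolution

variable {d : ℕ}

/-- A localization operator is the convolution of its mask with a rank-one operator. -/
theorem locIntegrand_eq_convIntegrand (f : Phase d → ℂ) (φ₁ φ₂ : L2 d) :
    locIntegrand f φ₁ φ₂ = convIntegrand f (rankOneOp φ₂ φ₁) := by
  funext z ψ
  simp [locIntegrand, convIntegrand, opShift, rankOneOp, stft,
    ContinuousLinearMap.adjoint_inner_right, smul_smul]

section WeakIntegral

variable {f : Phase d → ℂ} {S S' T T' : L2 d →L[ℂ] L2 d}

theorem IsWeakIntegral.conv_add (h : IsWeakIntegral (convIntegrand f S) T)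
    (h' : IsWeakIntegral (convIntegrand f S') T') :
    IsWeakIntegral (convIntegrand f (S + S')) (T + T') := fun ψ η => by
  have e : ∀ z, ⟪η, convIntegrand f (S + S') z ψ⟫_ℂ
      = ⟪η, convIntegrand f S z ψ⟫_ℂ + ⟪η, convIntegrand f S' z ψ⟫_ℂ := fun z => by
    simp [convIntegrand, opShift, inner_add_right]
  simp only [e]
  refine ⟨(h ψ η).1.add (h' ψ η).1, ?_⟩
  rw [integral_add (h ψ η).1 (h' ψ η).1, _root_.add_apply, inner_add_right, (h ψ η).2, (h' ψ η).2]

theorem IsWeakIntegral.conv_smul (a : ℂ) (h : IsWeakIntegral (convIntegrand f S) T) :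
    IsWeakIntegral (convIntegrand f (a • S)) (a • T) := fun ψ η => by
  have e : ∀ z, ⟪η, convIntegrand f (a • S) z ψ⟫_ℂ = a * ⟪η, convIntegrand f S z ψ⟫_ℂ := fun z => by
    simp only [convIntegrand, opShift, ContinuousLinearMap.comp_apply, _root_.smul_apply, map_smul,
      inner_smul_right]
    ring
  simp only [e]
  refine ⟨(h ψ η).1.const_mul a, ?_⟩
  rw [integral_const_mul, _root_.smul_apply, inner_smul_right, (h ψ η).2]

theorem IsWeakIntegral.conv_zero : IsWeakIntegral (convIntegrand f 0) 0 := fun ψ η => by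
  simp [convIntegrand, opShift]

theorem IsWeakIntegral.conv_sum {ι : Type*} (s : Finset ι) {S T : ι → L2 d →L[ℂ] L2 d}
    (h : ∀ i ∈ s, IsWeakIntegral (convIntegrand f (S i)) (T i)) :
    IsWeakIntegral (convIntegrand f (∑ i ∈ s, S i)) (∑ i ∈ s, T i) := by
  classical
  induction s using Finset.induction with
  | empty => simpa using IsWeakIntegral.conv_zero
  | insert a s ha ih =>
    rw [Finset.sum_insert ha, Finset.sum_insert ha]
    exact (h a (Finset.mem_insert_self a s)).conv_add
      (ih fun i hi => h i (Finset.mem_insert_of_mem hi))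

/-- A weak integral exists if the sesquilinear form which it has to represent is bounded. -/
theorem exists_isWeakIntegral {C : ℝ≥0∞} (hC : C ≠ ∞)
    (hmeas : ∀ ψ η, AEStronglyMeasurable (fun z => ⟪η, convIntegrand f S z ψ⟫_ℂ) volume)
    (hbound : ∀ ψ η, ∫⁻ z, ‖⟪η, convIntegrand f S z ψ⟫_ℂ‖ₑ ≤ ‖ψ‖ₑ * ‖η‖ₑ * C) :
    ∃ T : L2 d →L[ℂ] L2 d, IsWeakIntegral (convIntegrand f S) T := by
  have hint : ∀ ψ η, Integrable (fun z => ⟪η, convIntegrand f S z ψ⟫_ℂ) volume := fun ψ η =>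
    ⟨hmeas ψ η, (hbound ψ η).trans_lt (ENNReal.mul_lt_top
      (ENNReal.mul_lt_top enorm_lt_top enorm_lt_top) hC.lt_top)⟩
  have hint' : ∀ ψ η, Integrable (fun z => ⟪convIntegrand f S z ψ, η⟫_ℂ) volume := fun ψ η => by
    have := Complex.conjCLE.toContinuousLinearMap.integrable_comp (hint ψ η)
    simpa using this
  let B : L2 d →ₗ⋆[ℂ] L2 d →ₗ[ℂ] ℂ := LinearMap.mk₂'ₛₗ (starRingEnd ℂ) (RingHom.id ℂ)
    (fun ψ η => ∫ z, ⟪convIntegrand f S z ψ, η⟫_ℂ)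
    (fun ψ ψ' η => by
      rw [← integral_add (hint' ψ η) (hint' ψ' η)]
      simp only [convIntegrand, map_add, smul_add, inner_add_left])
    (fun a ψ η => by
      rw [smul_eq_mul, ← integral_const_mul]
      simp only [convIntegrand, map_smul, inner_smul_left]
      refine integral_congr_ae (Eventually.of_forall fun z => ?_)
      ring_nf)
    (fun ψ η η' => by
      rw [← integral_add (hint' ψ η) (hint' ψ η')]
      simp only [inner_add_right])
    (fun a ψ η => by
      rw [RingHom.id_apply, smul_eq_mul, ← integral_const_mul]
      simp only [inner_smul_right])
  have hB : ∀ ψ η, ‖B ψ η‖ ≤ C.toReal * ‖ψ‖ * ‖η‖ := fun ψ η => by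
    have h1 : ‖B ψ η‖ₑ ≤ ‖ψ‖ₑ * ‖η‖ₑ * C := by
      refine (enorm_integral_le_lintegral_enorm _).trans (le_trans (le_of_eq ?_) (hbound ψ η))
      exact lintegral_congr fun z => enorm_inner_comm _ _
    have h2 := ENNReal.toReal_mono (ENNReal.mul_ne_top
      (ENNReal.mul_ne_top enorm_ne_top enorm_ne_top) hC) h1
    simp only [ENNReal.toReal_mul, toReal_enorm] at h2
    linarith
  let B' : L2 d →L⋆[ℂ] L2 d →L[ℂ] ℂ := LinearMap.mkContinuous₂ B C.toReal hB
  refine ⟨InnerProductSpace.continuousLinearMapOfBilin B', fun ψ η => ⟨hint ψ η, ?_⟩⟩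
  rw [← inner_conj_symm, InnerProductSpace.continuousLinearMapOfBilin_apply]
  change (starRingEnd ℂ) (∫ z, ⟪convIntegrand f S z ψ, η⟫_ℂ) = _
  rw [← integral_conj]
  simp only [inner_conj_symm]

end WeakIntegral

variable {c : ℕ → ℂ} {φ₁ φ₂ : ℕ → L2 d} {S : L2 d →L[ℂ] L2 d} {f : Phase d → ℂ}

/-- Conjugation by `π(z)` shifts the two orthonormal families of a singular series. -/
theorem IsSingularSeries.conj_tfShift (hS : IsSingularSeries c φ₁ φ₂ S) (z : Phase d) :
    IsSingularSeries c (fun n => tfShift z (φ₁ n)) (fun n => tfShift z (φ₂ n)) (opShift z S) :=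
  fun ψ => by
  have := (hS (ContinuousLinearMap.adjoint (tfShift z) ψ)).mapL (tfShift z)
  simp only [map_smul, ContinuousLinearMap.adjoint_inner_right] at this
  exact this

theorem IsSingularSeries.measurable_inner_opShift (hS : IsSingularSeries c φ₁ φ₂ S) (ψ η : L2 d) :
    Measurable fun z => ⟪η, opShift z S ψ⟫_ℂ := by
  refine measurable_of_tendsto_metrizable
    (f := fun (N : ℕ) z => ∑ n ∈ Finset.range N,
      c n * (stft (φ₁ n) ψ z * (starRingEnd ℂ) (stft (φ₂ n) η z))) (fun N => ?_)
    (tendsto_pi_nhds.2 fun z => ?_)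
  · exact Finset.measurable_fun_sum _ fun n _ => ((measurable_stft _ _).mul
      (Complex.continuous_conj.measurable.comp (measurable_stft _ _))).const_mul _
  · have := ((hS.conj_tfShift z).hasSum_inner ψ η).tendsto_sum_nat
    simpa only [stft, inner_conj_symm] using this

/-- The pairing of the convolution with two vectors is dominated by the kernel
`|V_{φ₁ₙ}ψ(z)| |V_{φ₂ₙ}η(z)|`. -/
theorem IsSingularSeries.enorm_inner_convIntegrand_le (hS : IsSingularSeries c φ₁ φ₂ S)
    (z : Phase d) (ψ η : L2 d) :
    ‖⟪η, convIntegrand f S z ψ⟫_ℂ‖ₑ ≤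
      ‖f z‖ₑ * ∑' n, ‖c n‖ₑ * (‖stft (φ₁ n) ψ z‖ₑ * ‖stft (φ₂ n) η z‖ₑ) := by
  rw [convIntegrand, inner_smul_right, enorm_mul]
  gcongr
  exact (hS.conj_tfShift z).enorm_inner_le ψ η

theorem measurable_stft_kernel (φ₁ φ₂ : L2 d) (ψ η : L2 d) :
    Measurable fun z => ‖stft φ₁ ψ z‖ₑ * ‖stft φ₂ η z‖ₑ :=
  (measurable_stft _ _).enorm.mul (measurable_stft _ _).enorm

/-- The integrals of the kernel over phase space: Moyal's identity and the Cauchy-Schwarz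
inequality. -/
theorem lintegral_stft_kernel_le {φ₁ φ₂ : L2 d} (h₁ : ‖φ₁‖ = 1) (h₂ : ‖φ₂‖ = 1) (ψ η : L2 d) :
    ∫⁻ z, ‖stft φ₁ ψ z‖ₑ * ‖stft φ₂ η z‖ₑ ≤ ‖ψ‖ₑ * ‖η‖ₑ := by
  refine lintegral_mul_le_of_lintegral_sq_le (measurable_stft _ _).enorm.aemeasurable
    (measurable_stft _ _).enorm.aemeasurable ?_ ?_
  · simpa [enorm_eq_one_of_norm_eq_one h₁] using lintegral_enorm_stft_sq_le φ₁ ψ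
  · simpa [enorm_eq_one_of_norm_eq_one h₂] using lintegral_enorm_stft_sq_le φ₂ η

theorem tsum_stft_kernel_le (hφ₁ : Orthonormal ℂ φ₁) (hφ₂ : Orthonormal ℂ φ₂) (z : Phase d)
    (ψ η : L2 d) : ∑' n, ‖stft (φ₁ n) ψ z‖ₑ * ‖stft (φ₂ n) η z‖ₑ ≤ ‖ψ‖ₑ * ‖η‖ₑ :=
  tsum_enorm_inner_mul_le (orthonormal_tfShift z hφ₁) (orthonormal_tfShift z hφ₂) ψ η

/-- The Werner-Young inequality, for operators given by a singular series: `f ⋆ S` exists and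
`‖f ⋆ S‖_{𝒯ʳ} ≤ ‖f‖_q ‖c‖_p`. -/
theorem IsSingularSeries.exists_conv (hS : IsSingularSeries c φ₁ φ₂ S)
    (hφ₁ : Orthonormal ℂ φ₁) (hφ₂ : Orthonormal ℂ φ₂) {p q r : ℝ≥0∞} (hp : 1 ≤ p) (hq : 1 ≤ q)
    (hr : 1 ≤ r) (hp_top : p ≠ ∞) (hpqr : 1 / p + 1 / q = 1 + 1 / r) (hf : MemLp f q volume)
    (hc : ∑' n, ‖c n‖ₑ ^ p.toReal ≠ ∞) :
    ∃ T : L2 d →L[ℂ] L2 d, IsWeakIntegral (convIntegrand f S) T ∧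
      schattenNorm r T ≤ eLpNorm f q volume * (∑' n, ‖c n‖ₑ ^ p.toReal) ^ (1 / p.toReal) := by
  set C := eLpNorm f q volume * (∑' n, ‖c n‖ₑ ^ p.toReal) ^ (1 / p.toReal) with hCdef
  have hC : C ≠ ∞ := ENNReal.mul_ne_top hf.2.ne (ENNReal.rpow_ne_top_of_nonneg (by positivity) hc)
  have hb : ∀ ψ η, ∫⁻ z, ‖⟪η, convIntegrand f S z ψ⟫_ℂ‖ₑ ≤
      ∫⁻ z, ‖f z‖ₑ * ∑' n, ‖c n‖ₑ * (‖stft (φ₁ n) ψ z‖ₑ * ‖stft (φ₂ n) η z‖ₑ) := fun ψ η =>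
    lintegral_mono fun z => hS.enorm_inner_convIntegrand_le z ψ η
  have hbound : ∀ ψ η, ∫⁻ z, ‖⟪η, convIntegrand f S z ψ⟫_ℂ‖ₑ ≤ ‖ψ‖ₑ * ‖η‖ₑ * C := fun ψ η =>
    (hb ψ η).trans (lintegral_kernel_le_eLpNorm hp hq hr hp_top hpqr hf.1
      (fun n => measurable_stft_kernel _ _ ψ η) (fun z => tsum_stft_kernel_le hφ₁ hφ₂ z ψ η)
      (fun n => lintegral_stft_kernel_le (hφ₁.1 n) (hφ₂.1 n) ψ η))
  have hmeas : ∀ ψ η, AEStronglyMeasurable (fun z => ⟪η, convIntegrand f S z ψ⟫_ℂ) volume :=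
    fun ψ η => by
    simp only [convIntegrand, inner_smul_right]
    exact hf.1.mul (hS.measurable_inner_opShift ψ η).aestronglyMeasurable
  obtain ⟨T, hT⟩ := exists_isWeakIntegral hC hmeas hbound
  have hTle : ∀ ψ η, ‖⟪η, T ψ⟫_ℂ‖ₑ ≤ ∫⁻ z, ‖⟪η, convIntegrand f S z ψ⟫_ℂ‖ₑ := fun ψ η => by
    rw [(hT ψ η).2]; exact enorm_integral_le_lintegral_enorm _
  refine ⟨T, hT, ?_⟩
  by_cases hr_top : r = ∞
  · rw [schattenNorm, if_pos hr_top, ← ENNReal.ofReal_toReal hC, ← ofReal_norm]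
    refine ENNReal.ofReal_le_ofReal
      (T.opNorm_le_of_re_inner_le ENNReal.toReal_nonneg fun x y hx hy => ?_)
    have h1 := (hTle x y).trans (hbound x y)
    rw [enorm_eq_one_of_norm_eq_one hx, enorm_eq_one_of_norm_eq_one hy, one_mul, one_mul] at h1
    have h2 := ENNReal.toReal_mono hC h1
    rw [toReal_enorm] at h2
    exact (RCLike.re_le_norm _).trans ((norm_inner_symm _ _).trans_le h2)
  · refine schattenNorm_le_of_sum_inner_le hr hr_top hC fun ι _ e g he hg => ?_
    have h1 : ∀ i, ‖e i‖ₑ * ‖g i‖ₑ = 1 := fun i => by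
      rw [enorm_eq_one_of_norm_eq_one (he.1 i), enorm_eq_one_of_norm_eq_one (hg.1 i), one_mul]
    refine le_trans ?_ (sum_lintegral_kernel_rpow_le_eLpNorm (c := fun n => ‖c n‖ₑ) hp hq hr hp_top
      hr_top hpqr hf.1
      (k := fun i z n => ‖stft (φ₁ n) (e i) z‖ₑ * ‖stft (φ₂ n) (g i) z‖ₑ)
      (fun i n => measurable_stft_kernel _ _ _ _)
      (fun i z => (tsum_stft_kernel_le hφ₁ hφ₂ z _ _).trans_eq (h1 i))
      (fun i n => (lintegral_stft_kernel_le (hφ₁.1 n) (hφ₂.1 n) _ _).trans_eq (h1 i))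
      (fun z n => ?_))
    · gcongr with i
      exact (hTle _ _).trans (hb _ _)
    · have h2 := tsum_enorm_inner_mul_le he hg (tfShift z (φ₁ n)) (tfShift z (φ₂ n))
      rw [tsum_fintype, enorm_eq_one_of_norm_eq_one ((norm_tfShift z _).trans (hφ₁.1 n)),
        enorm_eq_one_of_norm_eq_one ((norm_tfShift z _).trans (hφ₂.1 n)), one_mul] at h2
      simpa only [stft, enorm_inner_comm (tfShift z _)] using h2

/-- The series of localization operators converges to the convolution: by linearity and the
Werner-Young inequality the error is controlled by the `ℓᵖ` norm of the remainder. -/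
theorem IsSingularSeries.hasSchattenSum_locOp (hS : IsSingularSeries c φ₁ φ₂ S)
    (hφ₁ : Orthonormal ℂ φ₁) (hφ₂ : Orthonormal ℂ φ₂) {p q r : ℝ≥0∞} (hp : 1 ≤ p) (hq : 1 ≤ q)
    (hr : 1 ≤ r) (hp_top : p ≠ ∞) (hpqr : 1 / p + 1 / q = 1 + 1 / r) (hf : MemLp f q volume)
    (hc : ∑' n, ‖c n‖ₑ ^ p.toReal ≠ ∞) :
    (∀ n, WeaklyIntegrable (locIntegrand f (φ₁ n) (φ₂ n))) ∧
      WeaklyIntegrable (convIntegrand f S) ∧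
      HasSchattenSum r (fun n => c n • locOp f (φ₁ n) (φ₂ n)) (opConv f S) := by
  have hp0 : 0 < p.toReal := ENNReal.toReal_pos (zero_lt_one.trans_le hp).ne' hp_top
  have hex : ∀ {c' : ℕ → ℂ} {R : L2 d →L[ℂ] L2 d}, IsSingularSeries c' φ₁ φ₂ R →
      ∑' n, ‖c' n‖ₑ ^ p.toReal ≠ ∞ → ∃ T : L2 d →L[ℂ] L2 d, IsWeakIntegral (convIntegrand f R) T ∧
      schattenNorm r T ≤ eLpNorm f q volume * (∑' n, ‖c' n‖ₑ ^ p.toReal) ^ (1 / p.toReal) :=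
    fun hR hc' => hR.exists_conv hφ₁ hφ₂ hp hq hr hp_top hpqr hf hc'
  have hmem : ∀ {c' : ℕ → ℂ} {R T : L2 d →L[ℂ] L2 d}, IsSingularSeries c' φ₁ φ₂ R →
      ∑' n, ‖c' n‖ₑ ^ p.toReal ≠ ∞ → IsWeakIntegral (convIntegrand f R) T →
      schattenNorm r T ≤ eLpNorm f q volume * (∑' n, ‖c' n‖ₑ ^ p.toReal) ^ (1 / p.toReal) :=
    fun hR hc' hT => by
    obtain ⟨T', hT', hle⟩ := hex hR hc'
    rwa [hT.unique hT']
  have hlt : ∀ {c' : ℕ → ℂ}, ∑' n, ‖c' n‖ₑ ^ p.toReal ≠ ∞ →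
      eLpNorm f q volume * (∑' n, ‖c' n‖ₑ ^ p.toReal) ^ (1 / p.toReal) < ∞ := fun hc' =>
    ENNReal.mul_lt_top hf.2 (ENNReal.rpow_lt_top_of_nonneg (by positivity) hc')
  have hone : ∀ n, ∃ T : L2 d →L[ℂ] L2 d, IsWeakIntegral (locIntegrand f (φ₁ n) (φ₂ n)) T :=
    fun n => by
    obtain ⟨T, hT, -⟩ := hex (isSingularSeries_single φ₁ φ₂ n 1)
      (tsum_enorm_single_rpow_ne_top hp0 n 1)
    rw [one_smul] at hT
    exact ⟨T, by rw [locIntegrand_eq_convIntegrand]; exact hT⟩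
  have hloc : ∀ n, IsWeakIntegral (convIntegrand f (c n • rankOneOp (φ₂ n) (φ₁ n)))
      (c n • locOp f (φ₁ n) (φ₂ n)) := fun n => by
    obtain ⟨T, hT⟩ := hone n
    rw [locOp, hT.weakIntegral_eq]
    rw [locIntegrand_eq_convIntegrand] at hT
    exact hT.conv_smul (c n)
  obtain ⟨T, hT, -⟩ := hex hS hc
  have hconv : opConv f S = T := hT.weakIntegral_eq
  refine ⟨hone, ⟨T, hT⟩, fun n => ?_, ?_, ?_⟩
  · have hsing := tsum_enorm_single_rpow_ne_top hp0 n (c n)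
    exact (hmem (isSingularSeries_single φ₁ φ₂ n (c n)) hsing (hloc n)).trans_lt (hlt hsing)
  · rw [hconv]
    exact (hmem hS hc hT).trans_lt (hlt hc)
  · have hzero := ENNReal.Tendsto.const_mul (a := eLpNorm f q volume)
      (tendsto_tail_lpNorm hp0 hc) (Or.inr hf.2.ne)
    rw [mul_zero] at hzero
    refine tendsto_of_tendsto_of_tendsto_of_le_of_le tendsto_const_nhds hzero
      (fun _ => zero_le) fun N => ?_
    refine hmem (hS.sum_range_sub N) (tsum_tail_ne_top hp0 hc N) ?_
    have hdiff := (IsWeakIntegral.conv_sum (Finset.range N) fun n _ => hloc n).conv_add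
      (hT.conv_smul (-1))
    rw [neg_one_smul, neg_one_smul, ← sub_eq_add_neg, ← sub_eq_add_neg] at hdiff
    rw [hconv]
    exact hdiff

end Convolution

/-! ### Singular value decompositions -/

section Extension

variable {H : Type*} [NormedAddCommGroup H] [InnerProductSpace ℂ H] [CompleteSpace H]

theorem exists_orthonormal_sumElim (hH : ¬ FiniteDimensional ℂ H) {ι : Type*} [Finite ι] {e : ι → H}
    (he : Orthonormal ℂ e) : ∃ u : ℕ → H, Orthonormal ℂ (Sum.elim e u) := by
  obtain ⟨w, b, hw, hb⟩ := he.toSubtypeRange.exists_hilbertBasis_extension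
  have hwinf : w.Infinite := fun hfin => by
    have hspan : FiniteDimensional ℂ (Submodule.span ℂ w) := FiniteDimensional.span_of_finite ℂ hfin
    have htop := b.dense_span
    rw [hb, Subtype.range_coe, (Submodule.closed_of_finiteDimensional _).submodule_topologicalClosure_eq]
      at htop
    rw [htop] at hspan
    exact hH (LinearEquiv.finiteDimensional (Submodule.topEquiv (R := ℂ) (M := H)))
  have hdiff : (w \ Set.range e).Infinite := hwinf.sdiff (Set.finite_range e)
  let u := hdiff.natEmbedding
  let φ : ι ⊕ ℕ → w := Sum.elim (fun i => ⟨e i, hw ⟨i, rfl⟩⟩) fun n => ⟨u n, (u n).2.1⟩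
  have hφ : Function.Injective φ := by
    refine Function.Injective.sumElim (fun i j hij => ?_) (fun m n hmn => ?_) fun i n hin => ?_
    · exact he.linearIndependent.injective (congrArg Subtype.val hij)
    · exact u.injective (Subtype.ext (congrArg (Subtype.val (p := (· ∈ w))) hmn))
    · exact (u n).2.2 ⟨i, congrArg Subtype.val hin⟩
  refine ⟨fun n => u n, ?_⟩
  have h1 := b.orthonormal.comp φ hφ
  rw [hb] at h1
  convert h1 using 1
  ext a
  cases a <;> rfl

/-- Expansion of a vector in an orthonormal family, up to a vector orthogonal to the family. -/
theorem exists_hasSum_inner_smul {ι : Type*} {e : ι → H} (he : Orthonormal ℂ e) (ψ : H) :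
    ∃ y, HasSum (fun j => ⟪e j, ψ⟫_ℂ • e j) y ∧ ∀ j, ⟪e j, ψ - y⟫_ℂ = 0 := by
  have hsum : Summable fun j => ⟪e j, ψ⟫_ℂ • e j := by
    have := (he.orthogonalFamily.summable_iff_norm_sq_summable fun j => ⟪e j, ψ⟫_ℂ).2
      (he.inner_products_summable ψ)
    simpa using this
  obtain ⟨y, hy⟩ := hsum
  refine ⟨y, hy, fun j => ?_⟩
  have h1 := hy.mapL (innerSL ℂ (e j))
  have h2 : HasSum (fun i => ⟪e j, ⟪e i, ψ⟫_ℂ • e i⟫_ℂ) ⟪e j, ψ⟫_ℂ := by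
    have := hasSum_single (f := fun i => ⟪e j, ⟪e i, ψ⟫_ℂ • e i⟫_ℂ) j fun i hi => by
      rw [inner_smul_right, he.2 hi.symm, mul_zero]
    simpa [inner_smul_right, inner_self_eq_norm_sq_to_K, he.1 j] using this
  rw [inner_sub_right, sub_eq_zero]
  exact h2.unique h1

end Extension

/-- For `d ≥ 1` the space `L²(ℝᵈ)` is infinite-dimensional: indicator functions of disjoint balls
are orthogonal. -/
theorem not_finiteDimensional_L2 {d : ℕ} (hd : 0 < d) : ¬ FiniteDimensional ℂ (L2 d) := by
  intro hfin
  let x : ℕ → Config d := fun n => EuclideanSpace.single ⟨0, hd⟩ (3 * n : ℝ)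
  have hdisj : ∀ m n, m ≠ n → Disjoint (Metric.ball (x m) 1) (Metric.ball (x n) 1) :=
    fun m n hmn => by
    refine Metric.ball_disjoint_ball ?_
    rw [show dist (x m) (x n) = dist (3 * m : ℝ) (3 * n) from
      PiLp.dist_single_same 2 (fun _ : Fin d => ℝ) _ _ _, Real.dist_eq, ← mul_sub, abs_mul]
    have h1 : (1 : ℝ) ≤ |(m : ℝ) - n| := by
      have : (1 : ℤ) ≤ |(m : ℤ) - n| := Int.one_le_abs (by omega)
      exact_mod_cast this
    norm_num
    linarith
  have hpos : ∀ n, 0 < (volume : Measure (Config d)).real (Metric.ball (x n) 1) := fun n =>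
    ENNReal.toReal_pos (Metric.measure_ball_pos volume _ one_pos).ne' measure_ball_lt_top.ne
  let v : ℕ → L2 d := fun n =>
    indicatorConstLp 2 (measurableSet_ball (x := x n) (ε := 1)) measure_ball_lt_top.ne (1 : ℂ)
  have hinner : ∀ m n, ⟪v m, v n⟫_ℂ
      = (volume : Measure (Config d)).real (Metric.ball (x m) 1 ∩ Metric.ball (x n) 1) :=
    fun m n => L2.inner_indicatorConstLp_one_indicatorConstLp_one _ _
  have hv : LinearIndependent ℂ v := by
    refine linearIndependent_of_ne_zero_of_inner_eq_zero (fun n h0 => ?_) fun m n hmn => ?_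
    · have h1 := hinner n n
      rw [h0, inner_zero_left, Set.inter_self] at h1
      exact (hpos n).ne (by exact_mod_cast h1)
    · change ⟪v m, v n⟫_ℂ = 0
      rw [hinner, (hdisj m n hmn).inter_eq]; simp
  exact not_finite_iff_infinite.2 inferInstance (hv.finite : Finite ℕ)

section SVD

variable {d : ℕ}

/-- Reindexing a singular value decomposition by the natural numbers. -/
theorem exists_isSingularSeries_of_countable {K : Type*} [Countable K] [Infinite K] {e g : K → L2 d}
    {σ : K → ℝ} {S : L2 d →L[ℂ] L2 d} {p : ℝ} (he : Orthonormal ℂ e) (hg : Orthonormal ℂ g)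
    (hσ : ∑' k, ENNReal.ofReal (σ k) ^ p ≠ ∞)
    (hS : ∀ ψ, HasSum (fun k => (σ k : ℂ) • ⟪e k, ψ⟫_ℂ • g k) (S ψ)) :
    ∃ (k : ℕ → K) (φ₁ φ₂ : ℕ → L2 d), Orthonormal ℂ φ₁ ∧ Orthonormal ℂ φ₂ ∧
      ∑' n, ENNReal.ofReal (σ (k n)) ^ p ≠ ∞ ∧
      IsSingularSeries (fun n => (σ (k n) : ℂ)) φ₁ φ₂ S := by
  obtain ⟨k⟩ := nonempty_equiv_of_countable (α := ℕ) (β := K)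
  refine ⟨k, e ∘ k, g ∘ k, he.comp k k.injective, hg.comp k k.injective, ?_, fun ψ => ?_⟩
  · rwa [k.tsum_eq fun a => ENNReal.ofReal (σ a) ^ p]
  · exact (k.hasSum_iff (f := fun a => (σ a : ℂ) • ⟪e a, ψ⟫_ℂ • g a)).2 (hS ψ)

/-- The singular value decomposition, indexed by the natural numbers. If there are only finitely many
singular values, the orthonormal families are extended and the sequence of singular values is
continued by zeros. -/
theorem exists_singularValueDecomposition (hd : 0 < d) {p : ℝ≥0∞} (hp : 1 ≤ p) (hp_top : p ≠ ∞)
    {S : L2 d →L[ℂ] L2 d} (hS : MemSchatten p S) :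
    ∃ (lam : ℕ → ℝ) (φ₁ φ₂ : ℕ → L2 d), (∀ n, 0 ≤ lam n) ∧
      (¬ FiniteDimensional ℂ (LinearMap.range (S : L2 d →ₗ[ℂ] L2 d)) → ∀ n, 0 < lam n) ∧
      Orthonormal ℂ φ₁ ∧ Orthonormal ℂ φ₂ ∧ ∑' n, ENNReal.ofReal (lam n) ^ p.toReal ≠ ∞ ∧
      IsSingularSeries (fun n => (lam n : ℂ)) φ₁ φ₂ S := by
  have hp0 : 0 < p.toReal := ENNReal.toReal_pos (zero_lt_one.trans_le hp).ne' hp_top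
  have hcomp : IsCompactOperator S := by
    by_contra h
    rw [MemSchatten, schattenNorm, if_neg hp_top, if_neg h] at hS
    exact lt_irrefl _ hS
  rw [MemSchatten, schattenNorm, if_neg hp_top, if_pos hcomp,
    ENNReal.rpow_lt_top_iff_of_pos (by positivity)] at hS
  obtain ⟨e, he, heig, hker⟩ := exists_singular_system hcomp
  let σ : SingularIndex S → ℝ := fun j => j.1
  have hσpos : ∀ j, 0 < σ j := fun j => j.1.2
  have hσ : ∑' j, ENNReal.ofReal (σ j) ^ p.toReal ≠ ∞ := by
    rw [ENNReal.tsum_sigma' fun j => ENNReal.ofReal (σ j) ^ p.toReal]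
    simpa [σ, tsum_fintype] using hS.ne
  have hcount : Countable (SingularIndex S) := by
    have := Summable.countable_support_ennreal hσ
    rw [← Set.countable_univ_iff]
    refine this.mono fun j _ => ?_
    simp [hσpos j, hp0, ENNReal.rpow_eq_zero_iff]
  let g : SingularIndex S → L2 d := fun j => (((σ j)⁻¹ : ℝ) : ℂ) • S (e j)
  have hg : Orthonormal ℂ g := orthonormal_smul_image hσpos he heig
  have hexp : ∀ ψ, HasSum (fun j => (σ j : ℂ) • ⟪e j, ψ⟫_ℂ • g j) (S ψ) := fun ψ => by
    obtain ⟨y, hy, hperp⟩ := exists_hasSum_inner_smul he ψ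
    have h1 := hker _ hperp
    rw [map_sub, sub_eq_zero] at h1
    rw [h1]
    convert hy.mapL S using 1
    ext1 j
    have : (σ j : ℂ) ≠ 0 := by exact_mod_cast (hσpos j).ne'
    simp only [g, map_smul]
    rw [smul_comm, smul_smul (σ j : ℂ)]
    push_cast
    rw [mul_inv_cancel₀ this, one_smul]
  rcases finite_or_infinite (SingularIndex S) with hfin | hinf
  · obtain ⟨u, hu⟩ := exists_orthonormal_sumElim (not_finiteDimensional_L2 hd) he
    obtain ⟨v, hv⟩ := exists_orthonormal_sumElim (not_finiteDimensional_L2 hd) hg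
    have hσ' : ∑' k, ENNReal.ofReal (Sum.elim σ (fun _ : ℕ => 0) k) ^ p.toReal ≠ ∞ := by
      rw [Summable.tsum_sum ENNReal.summable ENNReal.summable]
      simpa [hp0] using hσ
    have hexp' : ∀ ψ, HasSum (fun k => ((Sum.elim σ (fun _ : ℕ => 0) k : ℝ) : ℂ) •
        ⟪Sum.elim e u k, ψ⟫_ℂ • Sum.elim g v k) (S ψ) := fun ψ => by
      rw [← add_zero (S ψ)]
      refine HasSum.sum (hexp ψ) ?_
      have h0 : ∀ m : ℕ, ((Sum.elim σ (fun _ : ℕ => 0) (Sum.inr m) : ℝ) : ℂ) •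
          ⟪Sum.elim e u (Sum.inr m), ψ⟫_ℂ • Sum.elim g v (Sum.inr m) = 0 := fun m => by simp
      exact hasSum_zero.congr_fun h0
    obtain ⟨k, φ₁, φ₂, h1, h2, h3, h4⟩ := exists_isSingularSeries_of_countable hu hv hσ' hexp'
    refine ⟨_, φ₁, φ₂, fun n => ?_, fun hinf => (hinf ?_).elim, h1, h2, h3, h4⟩
    · rcases k n with j | m
      · exact (hσpos j).le
      · exact le_rfl
    · have hspan : FiniteDimensional ℂ (Submodule.span ℂ (Set.range g)) :=
        FiniteDimensional.span_of_finite ℂ (Set.finite_range g)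
      refine Submodule.finiteDimensional_of_le (S₂ := Submodule.span ℂ (Set.range g)) ?_
      rintro _ ⟨ψ, rfl⟩
      have hfs := Fintype.ofFinite (SingularIndex S)
      have hSψ := (hexp ψ).unique (hasSum_fintype _)
      change S ψ ∈ _
      rw [hSψ]
      exact Submodule.sum_mem _ fun j _ => Submodule.smul_mem _ _ (Submodule.smul_mem _ _
        (Submodule.subset_span ⟨j, rfl⟩))
  · obtain ⟨k, φ₁, φ₂, h1, h2, h3, h4⟩ := exists_isSingularSeries_of_countable he hg hσ hexp
    exact ⟨_, φ₁, φ₂, fun n => (hσpos _).le, fun _ n => hσpos _, h1, h2, h3, h4⟩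

end SVD

theorem mainTheorem9 (d : ℕ) (hd : 0 < d) (p q r : ℝ≥0∞)
    (hp : 1 ≤ p) (hq : 1 ≤ q) (hr : 1 ≤ r) (hp_top : p ≠ ∞)
    (hpqr : 1 / p + 1 / q = 1 + 1 / r) :
    (∀ φ₁ φ₂ : ℕ → L2 d, Orthonormal ℂ φ₁ → Orthonormal ℂ φ₂ →
      ∀ lam : ℕ → ℂ, Memℓp lam p →
      ∃ S : L2 d →L[ℂ] L2 d,
        HasSchattenSum p (fun n => lam n • rankOneOp (φ₂ n) (φ₁ n)) S ∧
        ∀ f : Phase d → ℂ, MemLp f q volume →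
          (∀ n, WeaklyIntegrable (locIntegrand f (φ₁ n) (φ₂ n))) ∧
          WeaklyIntegrable (convIntegrand f S) ∧
          HasSchattenSum r (fun n => lam n • locOp f (φ₁ n) (φ₂ n)) (opConv f S)) ∧
    (∀ S : L2 d →L[ℂ] L2 d, MemSchatten p S →
      ∃ (lam : ℕ → ℝ) (φ₁ φ₂ : ℕ → L2 d),
        (∀ n, 0 ≤ lam n) ∧
        (¬ FiniteDimensional ℂ (LinearMap.range (S : L2 d →ₗ[ℂ] L2 d)) → ∀ n, 0 < lam n) ∧
        Memℓp lam p ∧ Orthonormal ℂ φ₁ ∧ Orthonormal ℂ φ₂ ∧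
        HasSchattenSum p (fun n => (lam n : ℂ) • rankOneOp (φ₂ n) (φ₁ n)) S ∧
        ∀ f : Phase d → ℂ, MemLp f q volume →
          (∀ n, WeaklyIntegrable (locIntegrand f (φ₁ n) (φ₂ n))) ∧
          WeaklyIntegrable (convIntegrand f S) ∧
          HasSchattenSum r (fun n => (lam n : ℂ) • locOp f (φ₁ n) (φ₂ n)) (opConv f S)) := by

  refine ⟨fun φ₁ φ₂ hφ₁ hφ₂ lam hlam => ?_, fun S hS => ?_⟩
  · obtain ⟨S, hS⟩ := exists_isSingularSeries hφ₁ hφ₂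
      (tendsto_cofinite_zero_of_memℓp hp hp_top hlam)
    have hc := tsum_enorm_rpow_ne_top_of_memℓp hp hp_top hlam
    exact ⟨S, hS.hasSchattenSum hφ₁ hφ₂ hp hp_top hc, fun f hf =>
      hS.hasSchattenSum_locOp hφ₁ hφ₂ hp hq hr hp_top hpqr hf hc⟩
  · obtain ⟨lam, φ₁, φ₂, hnonneg, hpos, hφ₁, hφ₂, hsum, hser⟩ :=
      exists_singularValueDecomposition hd hp hp_top hS
    have hnorm : ∀ n, ENNReal.ofReal (lam n) = ‖(lam n : ℂ)‖ₑ := fun n => by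
      rw [← ofReal_norm, Complex.norm_real, Real.norm_of_nonneg (hnonneg n)]
    have hc : ∑' n, ‖(lam n : ℂ)‖ₑ ^ p.toReal ≠ ∞ := by simpa only [hnorm] using hsum
    have hlam : Memℓp lam p := by
      refine memℓp_gen ?_
      refine (ENNReal.summable_toReal hc).congr fun n => ?_
      rw [← ENNReal.toReal_rpow, toReal_enorm, Complex.norm_real]
    exact ⟨lam, φ₁, φ₂, hnonneg, hpos, hlam, hφ₁, hφ₂, hser.hasSchattenSum hφ₁ hφ₂ hp hp_top hc,
      fun f hf => hser.hasSchattenSum_locOp hφ₁ hφ₂ hp hq hr hp_top hpqr hf hc⟩
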